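/- **Notation.** Let $\mathbb H$ be the skew field of real quaternions; $M^*$ is the conjugate transpose and $\operatorname{rk} M$ the rank (dimension of the right column space) of a quaternion matrix $M$. The index $\operatorname{Ind} M$ of a square matrix is the smallest positive integer $k$ with $\operatorname{rk} M^{k+1}=\operatorname{rk} M^k$. For $M=(m_{ij})\in\mathbb H^{n\times n}$ and $1\le i\le n$, the $i$-th row determinant is $$\operatorname{rdet}_i M=\sum_{\sigma\in S_n}(-1)^{n-q}\,(m_{i\,\sigma(i)}m_{\sigma(i)\,\sigma^2(i)}\cdots m_{\sigma^{l_1}(i)\,i})\,(m_{c_2\,\sigma(c_2)}\cdots m_{\sigma^{l_2}(c_2)\,c_2})\cdots(m_{c_q\,\sigma(c_q)}\cdots m_{\sigma^{l_q}(c_q)\,c_q}),$$ where $q$ is the number of cycles of $\sigma$ (fixed points included), the first cycle starts with $i$, each other cycle starts with its least element $c_t$, and $c_2<\cdots<c_q$. If $M$ is Hermitian, all $\operatorname{rdet}_i M$ are equal, and this common value is $\det M$. The determinant of the empty matrix is $1$. $I_{r,n}$ is the set of $r$-element subsets of $\{1,\dots,n\}$, and $I_{r,n}\{j\}$ is the set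 of those that contain $j$. $M_\alpha^\alpha$ is the principal submatrix with rows and columns indexed by $\alpha$, and $|M|_\alpha^\alpha=\det M_\alpha^\alpha$ for Hermitian $M$. $M_{j.}(b)$ is $M$ with its $j$-th row replaced by the row $b$; in $\operatorname{rdet}_j(\,\cdot\,)_\alpha^\alpha$ the index $j$ refers to the row of the submatrix that comes from row $j$. For $A\in\mathbb H^{m\times n}$, $A^\dagger$ is the Moore–Penrose inverse, the unique $Y$ with $AYA=A$, $YAY=Y$, $(AY)^*=AY$, $(YA)^*=YA$. For $W\in\mathbb H^{n\times m}$, $A^{d,W}$ is the $W$-weighted Drazin inverse, the unique $X$ with $(AW)^{p+1}XW=(AW)^p$, $XWAWX=X$, $AWX=XWA$, where $p=\operatorname{Ind}(AW)$. For $W\neq0$, the $W$-weighted DMP inverse of $A$ is $$A^{d,\dagger,W}=W A^{d,W} W A A^\dagger\in\mathbb H^{n\times m}.$$ **Theorem.** Let $A\in\mathbb H^{m\times n}$ with $\operatorname{rk}A=r$, let $W\in\mathbb H^{n\times m}$ be nonzero, put $U=WA$, $k=\max\{\operatorname{Ind}(WA),\operatorname{Ind}(AW)\}$ and $r_1=\operatorname{rk}U^k$.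 Then $A^{d,W}$ and $A^\dagger$ exist and are unique, all denominators below are nonzero, and $A^{d,\dagger,W}=(a_{ij}^{d,\dagger,W})$ has the following determinantal representations for $1\le i\le n$, $1\le j\le m$. (i) For arbitrary $WA$, put $B=U^{2k+1}(U^{2k+1})^*$. Then $$a^{d,\dagger,W}_{ij}=\frac{\sum_{\alpha\in I_{r,m}\{j\}}\operatorname{rdet}_j\big((AA^*)_{j.}(\widetilde\omega_{i.})\big)_\alpha^\alpha}{\sum_{\alpha\in I_{r,m}}|AA^*|_\alpha^\alpha\;\Big(\sum_{\alpha\in I_{r_1,n}}|B|_\alpha^\alpha\Big)^2},$$ where $\widetilde\omega_{i.}$ is the $i$-th row of $\widetilde\Omega=\Omega\,(WA)^{k+1}A^*$ and $\Omega=(\omega_{is})\in\mathbb H^{n\times n}$ is given by $$\omega_{is}=\sum_{\alpha\in I_{r_1,n}\{s\}}\operatorname{rdet}_s\big(B_{s.}(\widehat\phi_{i.})\big)_\alpha^\alpha,$$ with $\widehat\phi_{i.}$ the $i$-th row of $\widehat\Phi=WA\,\Phi\,U^{2k}(U^{2k+1})^*$, where $\Phi=(\phi_{lq})\in\mathbb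 H^{n\times n}$ is given by $$\phi_{lq}=\sum_{\alpha\in I_{r_1,n}\{q\}}\operatorname{rdet}_q\big(B_{q.}(\check u_{l.})\big)_\alpha^\alpha,$$ with $\check u_{l.}$ the $l$-th row of $\check U=U^k(U^{2k+1})^*$. (ii) If $WA$ is Hermitian, then $$a^{d,\dagger,W}_{ij}=\frac{\sum_{\alpha\in I_{r,m}\{j\}}\operatorname{rdet}_j\big((AA^*)_{j.}(\widetilde\omega_{i.})\big)_\alpha^\alpha}{\sum_{\alpha\in I_{r,m}}|AA^*|_\alpha^\alpha\;\sum_{\alpha\in I_{r_1,n}}|(WA)^{k+2}|_\alpha^\alpha},$$ where $\widetilde\omega_{i.}$ is the $i$-th row of $\widetilde\Omega=\Omega\,WAA^*$ and $\Omega=(\omega_{is})\in\mathbb H^{n\times n}$ is given by $$\omega_{is}=\sum_{\alpha\in I_{r_1,n}\{s\}}\operatorname{rdet}_s\big(((WA)^{k+2})_{s.}(\widehat u_{i.})\big)_\alpha^\alpha,$$ with $\widehat u_{i.}$ the $i$-th row of $\widehat U=(WA)^{k+1}$. -/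

import Mathlib

open scoped Quaternion Matrix

namespace QMat

section RowDeterminant

variable {ι R : Type*} [Fintype ι] [LinearOrder ι] [Ring R]

/-- The ordered product `a_{x, σ x} * a_{σ x, σ² x} * ⋯ * a_{σ^l x, x}` of the entries of `M` along
the cycle of `σ` that starts with `x` (for a fixed point `x` this is `a_{x, x}`). -/
noncomputable def cycleProd (M : Matrix ι ι R) (σ : Equiv.Perm ι) (x : ι) : R :=
  ((List.range (Function.minimalPeriod σ x)).map fun t => M ((σ ^ t) x) ((σ ^ (t + 1)) x)).prod

/-- The first elements, from left to right, of the disjoint cycles (fixed points included) of the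
left-ordered cycle notation of `σ` with respect to `i`: the first cycle starts with `i`, every other
cycle starts with its least element, and these least elements increase from left to right. -/
def cycleStarts (σ : Equiv.Perm ι) (i : ι) : List ι :=
  i :: (Finset.univ.filter fun x : ι => ¬ σ.SameCycle i x ∧ ∀ y, σ.SameCycle x y → x ≤ y).sort
    (· ≤ ·)

/-- The `i`-th row determinant: `∑_σ (-1)^(n - r)` times the ordered product, over the `r` cycles of
the left-ordered cycle notation of `σ`, of the entries along these cycles. -/
noncomputable def rdet (M : Matrix ι ι R) (i : ι) : R :=
  ∑ σ : Equiv.Perm ι,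
    (-1 : R) ^ (Fintype.card ι - (cycleStarts σ i).length) *
      ((cycleStarts σ i).map (cycleProd M σ)).prod

/-- The determinant of a Hermitian matrix, the common value of all its row determinants: it is
computed along the first row, and it is `1` for the empty matrix. -/
noncomputable def hermDet (M : Matrix ι ι R) : R :=
  if h : (Finset.univ : Finset ι).Nonempty then rdet M (Finset.univ.min' h) else 1

/-- The principal submatrix with rows and columns indexed by `α`. -/
def principalSub (M : Matrix ι ι R) (α : Finset ι) : Matrix α α R :=
  M.submatrix Subtype.val Subtype.val

/-- `∑_{α ∈ I_r} |M|_α^α`: the sum of all principal minors of order `r` of a Hermitian matrix. -/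
noncomputable def minorSum (M : Matrix ι ι R) (r : ℕ) : R :=
  ∑ α ∈ Finset.powersetCard r (Finset.univ : Finset ι), hermDet (principalSub M α)

/-- `∑_{α ∈ I_r{j}} rdet_j (M_{j.}(b))_α^α`: the `j`-th row of `M` is replaced by `b`, and the `j`-th
row determinants of the principal submatrices with index set `α ∋ j` of size `r` are added. -/
noncomputable def rowMinorSum (M : Matrix ι ι R) (r : ℕ) (j : ι) (b : ι → R) : R :=
  ∑ α : {α : Finset ι // α.card = r ∧ j ∈ α},
    rdet (principalSub (M.updateRow j b) α.1) ⟨j, α.2.2⟩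

end RowDeterminant

section GeneralizedInverses

variable {m n : ℕ}

/-- The rank of a quaternion matrix: the dimension of its right column space, the span of its
columns for the multiplication by scalars from the right. -/
noncomputable def rk (A : Matrix (Fin m) (Fin n) ℍ[ℝ]) : ℕ :=
  Module.finrank ℍ[ℝ]ᵐᵒᵖ (Submodule.span ℍ[ℝ]ᵐᵒᵖ (Set.range A.col))

/-- The index: the smallest positive `k` with `rk (A ^ (k + 1)) = rk (A ^ k)`. -/
noncomputable def ind (A : Matrix (Fin n) (Fin n) ℍ[ℝ]) : ℕ :=
  sInf {k : ℕ | 0 < k ∧ rk (A ^ (k + 1)) = rk (A ^ k)}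

/-- `X` satisfies the four Penrose equations for `A`. -/
def IsMoorePenrose (A : Matrix (Fin m) (Fin n) ℍ[ℝ]) (X : Matrix (Fin n) (Fin m) ℍ[ℝ]) : Prop :=
  A * X * A = A ∧ X * A * X = X ∧ (A * X)ᴴ = A * X ∧ (X * A)ᴴ = X * A

/-- `X` satisfies the equations of the `W`-weighted Drazin inverse of `A`. -/
def IsWeightedDrazin (A : Matrix (Fin m) (Fin n) ℍ[ℝ]) (W : Matrix (Fin n) (Fin m) ℍ[ℝ])
    (X : Matrix (Fin m) (Fin n) ℍ[ℝ]) : Prop :=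
  (A * W) ^ (ind (A * W) + 1) * X * W = (A * W) ^ ind (A * W) ∧
    X * W * A * W * X = X ∧ A * W * X = X * W * A

open Classical in
/-- The Moore-Penrose inverse. -/
noncomputable def moorePenrose (A : Matrix (Fin m) (Fin n) ℍ[ℝ]) : Matrix (Fin n) (Fin m) ℍ[ℝ] :=
  if h : ∃ X, IsMoorePenrose A X then h.choose else 0

open Classical in
/-- The `W`-weighted Drazin inverse. -/
noncomputable def weightedDrazin (A : Matrix (Fin m) (Fin n) ℍ[ℝ])
    (W : Matrix (Fin n) (Fin m) ℍ[ℝ]) : Matrix (Fin m) (Fin n) ℍ[ℝ] :=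
  if h : ∃ X, IsWeightedDrazin A W X then h.choose else 0

/-- The `W`-weighted DMP inverse. -/
noncomputable def wdmp (A : Matrix (Fin m) (Fin n) ℍ[ℝ])
    (W : Matrix (Fin n) (Fin m) ℍ[ℝ]) : Matrix (Fin n) (Fin m) ℍ[ℝ] :=
  W * weightedDrazin A W * W * A * moorePenrose A

end GeneralizedInverses

end QMat

/-!
Expanding the `j`-th row determinant along its row, the numerators `∑ rdet_j (M_{j.}(b))_α^α` become
the entries of `b * N`, where `N` is a sum of adjugates of principal submatrices of `M`. Hermitian
quaternion matrices have a Laplace expansion, by induction on the size: self-adjoint quaternions are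
central, and the equality of the row determinants follows from computing an entry of
`M * adj M * M` in two ways if the matrix entry there is nonzero, and by continuity otherwise.
Hence the adjugate sums `N_k` and the sums `d_k` of principal minors satisfy the Faddeev-LeVerrier
recursion `N_{k+1} = d_k - M * N_k`. If `d_r` is the last nonzero coefficient, then
`M * N_r * M = d_r M`, and comparing the trace of the idempotent `d_r⁻¹ M * N_r` with its rank gives
`r = rk M`. For `M = A * Aᴴ` this is Cramer's rule for the Moore-Penrose inverse `A†`.

It remains to express the weighted inverse in these terms. By Cline's formula, `W * A^{d,W}` is the
Drazin inverse `E` of `U = W * A`, so `A^{d,†,W} = E * U * A†`. Finally `E` equals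
`U^k * (U^(2k+1))† * U^k`; in the Hermitian case `E * U = U^(k+1) * G * U` for any inner inverse `G`
of `U^(k+2)`.
-/

namespace QMat

open Equiv Finset Function

section Permutations

variable {ι κ : Type*} {σ τ : Perm ι} {x y : ι}

lemma mem_permsOfFinset_iff_forall_notMem [DecidableEq ι] {α : Finset ι} :
    σ ∈ permsOfFinset α ↔ ∀ x ∉ α, σ x = x := by
  simp only [mem_perms_of_finset_iff, ne_eq, not_imp_comm]

lemma mapsTo_of_mem_permsOfFinset [DecidableEq ι] {α : Finset ι} (hσ : σ ∈ permsOfFinset α) :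
    Set.MapsTo σ α α := fun x hx => by
  by_contra hσx
  have hfix := σ.injective (mem_permsOfFinset_iff_forall_notMem.1 hσ _ hσx)
  exact hσx (hfix.symm ▸ hx)

lemma ofSubtype_mem_permsOfFinset [DecidableEq ι] {α : Finset ι} (τ : Perm α) :
    Perm.ofSubtype τ ∈ permsOfFinset α :=
  mem_permsOfFinset_iff_forall_notMem.2 fun _ hx => Perm.ofSubtype_apply_of_not_mem τ hx

lemma filter_permsOfFinset_apply_eq_self [DecidableEq ι] (α : Finset ι) (j : ι) :
    {σ ∈ permsOfFinset α | σ j = j} = permsOfFinset (α.erase j) := by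
  ext σ
  simp only [mem_filter, mem_permsOfFinset_iff_forall_notMem, mem_erase, not_and_or, not_not]
  refine ⟨?_, fun h => ⟨fun x hx => h x (Or.inr hx), h j (Or.inl rfl)⟩⟩
  rintro ⟨h, hj⟩ x (rfl | hx)
  exacts [hj, h x hx]

lemma sum_perm_subtype [DecidableEq ι] {S : Type*} [AddCommMonoid S] (α : Finset ι)
    (f : Perm ι → S) : ∑ τ : Perm α, f (Perm.ofSubtype τ) = ∑ σ ∈ permsOfFinset α, f σ := by
  refine sum_bij (fun τ _ => Perm.ofSubtype τ) (fun τ _ => ofSubtype_mem_permsOfFinset τ)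
    (fun _ _ _ _ h => Perm.ofSubtype_injective h) (fun σ hσ => ?_) (fun _ _ => rfl)
  let e := Perm.subtypeEquivSubtypePerm (· ∈ α)
  let σ' : {σ : Perm ι // ∀ x ∉ α, σ x = x} := ⟨σ, mem_permsOfFinset_iff_forall_notMem.1 hσ⟩
  exact ⟨e.symm σ', mem_univ _, congrArg Subtype.val (e.apply_symm_apply σ')⟩

lemma mem_of_sameCycle_of_mapsTo [Finite ι] {S : Set ι} (hS : Set.MapsTo σ S S) (hx : x ∈ S)
    (h : σ.SameCycle x y) : y ∈ S := by
  obtain ⟨t, rfl⟩ := h.exists_nat_pow_eq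
  rw [Perm.coe_pow]
  exact hS.iterate t hx

lemma sameCycle_iff_exists_nat_pow_eq [Finite ι] : σ.SameCycle x y ↔ ∃ t : ℕ, (σ ^ t) x = y :=
  ⟨Perm.SameCycle.exists_nat_pow_eq, fun ⟨t, ht⟩ => ⟨t, by rwa [zpow_natCast]⟩⟩

lemma sameCycle_congr [Finite ι] (h : ∀ t : ℕ, (σ ^ t) x = (τ ^ t) x) :
    σ.SameCycle x y ↔ τ.SameCycle x y := by
  simp only [sameCycle_iff_exists_nat_pow_eq, h]

lemma sameCycle_right_iff_eq_of_apply_eq [Finite ι] (hy : σ y = y) : σ.SameCycle x y ↔ x = y := by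
  rw [Perm.sameCycle_comm]
  refine ⟨mem_of_sameCycle_of_mapsTo (S := {y}) (by simp [hy]) rfl, ?_⟩
  rintro rfl
  exact Perm.SameCycle.refl _ _

lemma minimalPeriod_pos [Finite ι] (σ : Perm ι) (x : ι) : 0 < minimalPeriod σ x :=
  minimalPeriod_pos_of_mem_periodicPts (σ.injective.mem_periodicPts x)

lemma pow_minimalPeriod_apply (σ : Perm ι) (x : ι) : (σ ^ minimalPeriod σ x) x = x := by
  rw [Perm.coe_pow, iterate_minimalPeriod]

lemma minimalPeriod_le_of_pow_apply_eq {t : ℕ} (ht : 0 < t) (h : (σ ^ t) x = x) :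
    minimalPeriod σ x ≤ t := by
  rw [Perm.coe_pow] at h
  exact IsPeriodicPt.minimalPeriod_le ht h

lemma minimalPeriod_congr {τ : Perm κ} {y : κ} (h : ∀ t : ℕ, (σ ^ t) x = x ↔ (τ ^ t) y = y) :
    minimalPeriod σ x = minimalPeriod τ y := by
  simpa only [minimalPeriod_eq_minimalPeriod_iff, IsPeriodicPt, IsFixedPt, ← Perm.coe_pow] using h

lemma ofSubtype_pow_apply {p : ι → Prop} [DecidablePred p] (τ : Perm (Subtype p)) (t : ℕ)
    (x : Subtype p) : (Perm.ofSubtype τ ^ t) (x : ι) = (τ ^ t) x := by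
  rw [← map_pow, Perm.ofSubtype_apply_coe]

lemma sameCycle_ofSubtype [Finite ι] {p : ι → Prop} [DecidablePred p] (τ : Perm (Subtype p))
    (x y : Subtype p) : (Perm.ofSubtype τ).SameCycle (x : ι) y ↔ τ.SameCycle x y := by
  simp only [sameCycle_iff_exists_nat_pow_eq, ofSubtype_pow_apply, Subtype.coe_inj]

end Permutations

section InsertIntoCycle

variable {ι : Type*} [DecidableEq ι] {τ : Perm ι} {j s x : ι}

-- If `τ` fixes `s`, then `τ * swap j s` is `τ` with `s` inserted after `j` into the cycle of `j`.

lemma mul_swap_apply_left (hs : τ s = s) : (τ * swap j s) j = s := by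
  rw [Perm.mul_apply, swap_apply_left, hs]

lemma mul_swap_apply_right : (τ * swap j s) s = τ j := by
  rw [Perm.mul_apply, swap_apply_right]

lemma mul_swap_apply_of_ne_of_ne (hj : x ≠ j) (hs : x ≠ s) : (τ * swap j s) x = τ x := by
  rw [Perm.mul_apply, swap_apply_of_ne_of_ne hj hs]

lemma sameCycle_mul_swap [Finite ι] (hs : τ s = s) :
    (τ * swap j s).SameCycle j x ↔ τ.SameCycle j x ∨ x = s := by
  have hjs : (τ * swap j s).SameCycle j s :=
    sameCycle_iff_exists_nat_pow_eq.2 ⟨1, mul_swap_apply_left hs⟩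
  constructor
  · refine mem_of_sameCycle_of_mapsTo (S := {x | τ.SameCycle j x ∨ x = s}) (fun z hz => ?_)
      (Or.inl (Perm.SameCycle.refl _ _))
    obtain rfl | hzs := eq_or_ne z s
    · rw [mul_swap_apply_right]
      exact Or.inl (Perm.sameCycle_apply_right.2 (Perm.SameCycle.refl _ _))
    obtain rfl | hzj := eq_or_ne z j
    · exact Or.inr (mul_swap_apply_left hs)
    · rw [mul_swap_apply_of_ne_of_ne hzj hzs]
      exact Or.inl (Perm.sameCycle_apply_right.2 (hz.resolve_right hzs))
  · rintro (h | rfl)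
    · refine mem_of_sameCycle_of_mapsTo (S := {x | (τ * swap j s).SameCycle j x}) (fun z hz => ?_)
        (Perm.SameCycle.refl _ _) h
      obtain rfl | hzs := eq_or_ne z s
      · exact hs.symm ▸ hjs
      obtain rfl | hzj := eq_or_ne z j
      · rw [← mul_swap_apply_right (τ := τ) (j := z) (s := s)]
        exact Perm.sameCycle_apply_right.2 hjs
      · rw [← mul_swap_apply_of_ne_of_ne hzj hzs]
        exact Perm.sameCycle_apply_right.2 hz
    · exact hjs

lemma mul_swap_pow_apply_of_not_sameCycle [Finite ι] (hs : τ s = s)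
    (hx : ¬ (τ * swap j s).SameCycle j x) (t : ℕ) : ((τ * swap j s) ^ t) x = (τ ^ t) x := by
  induction t with
  | zero => rfl
  | succ t ih =>
    have hz : ¬ (τ * swap j s).SameCycle j (((τ * swap j s) ^ t) x) := by
      rwa [Perm.sameCycle_pow_right]
    have hzj : ((τ * swap j s) ^ t) x ≠ j := fun h => hz (h.symm ▸ Perm.SameCycle.refl _ _)
    have hzs : ((τ * swap j s) ^ t) x ≠ s := fun h => hz ((sameCycle_mul_swap hs).2 (Or.inr h))
    rw [pow_succ', Perm.mul_apply (τ * swap j s), mul_swap_apply_of_ne_of_ne hzj hzs, ih, pow_succ',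
      Perm.mul_apply]

lemma mul_swap_pow_succ_apply_left [Finite ι] (hs : τ s = s) (hsj : s ≠ j) {t : ℕ} (ht₀ : 0 < t)
    (ht : t ≤ minimalPeriod τ j) : ((τ * swap j s) ^ (t + 1)) j = (τ ^ t) j := by
  induction t, ht₀ using Nat.le_induction with
  | base =>
    rw [pow_succ', Perm.mul_apply (τ * swap j s), pow_one, pow_one, mul_swap_apply_left hs,
      mul_swap_apply_right]
  | succ t ht₀ ih =>
    have hzj : (τ ^ t) j ≠ j := fun h => (minimalPeriod_le_of_pow_apply_eq ht₀ h).not_gt ht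
    have hzs : (τ ^ t) j ≠ s := fun h =>
      hsj.symm ((sameCycle_right_iff_eq_of_apply_eq hs).1
        (sameCycle_iff_exists_nat_pow_eq.2 ⟨t, h⟩))
    rw [pow_succ', Perm.mul_apply (τ * swap j s), ih (Nat.le_of_succ_le ht),
      mul_swap_apply_of_ne_of_ne hzj hzs, pow_succ', Perm.mul_apply]

lemma minimalPeriod_mul_swap [Finite ι] (hs : τ s = s) (hsj : s ≠ j) :
    minimalPeriod (τ * swap j s) j = minimalPeriod τ j + 1 := by
  apply le_antisymm
  · apply minimalPeriod_le_of_pow_apply_eq (Nat.succ_pos _)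
    rw [mul_swap_pow_succ_apply_left hs hsj (minimalPeriod_pos τ j) le_rfl,
      pow_minimalPeriod_apply]
  · by_contra! hlt
    obtain ⟨t, ht⟩ := Nat.exists_eq_succ_of_ne_zero (minimalPeriod_pos (τ * swap j s) j).ne'
    have hper := pow_minimalPeriod_apply (τ * swap j s) j
    rw [ht] at hlt hper
    obtain rfl | ht₀ := t.eq_zero_or_pos
    · exact hsj ((mul_swap_apply_left hs).symm.trans hper)
    · rw [mul_swap_pow_succ_apply_left hs hsj ht₀ (by omega)] at hper
      have := minimalPeriod_le_of_pow_apply_eq ht₀ hper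
      omega

lemma filter_permsOfFinset_apply_eq {α : Finset ι} (hj : j ∈ α) (hs : s ∈ α) :
    {σ ∈ permsOfFinset α | σ j = s} =
      (permsOfFinset (α.erase s)).map (mulRightEmbedding (swap j s)) := by
  ext σ
  simp only [mem_filter, mem_permsOfFinset_iff_forall_notMem, mem_map, mulRightEmbedding_apply,
    mem_erase, not_and_or, not_not]
  have hne {x : ι} (hx : x ∉ α) : x ≠ j ∧ x ≠ s :=
    ⟨ne_of_mem_of_not_mem hj hx |>.symm, ne_of_mem_of_not_mem hs hx |>.symm⟩
  constructor
  · rintro ⟨h, hσ⟩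
    refine ⟨σ * swap j s, ?_, by rw [mul_assoc, swap_mul_self, mul_one]⟩
    rintro x (rfl | hx)
    · rw [mul_swap_apply_right, hσ]
    · rw [mul_swap_apply_of_ne_of_ne (hne hx).1 (hne hx).2, h x hx]
  · rintro ⟨τ, h, rfl⟩
    refine ⟨fun x hx => ?_, mul_swap_apply_left (h s (Or.inl rfl))⟩
    rw [mul_swap_apply_of_ne_of_ne (hne hx).1 (hne hx).2, h x (Or.inr hx)]

end InsertIntoCycle

section CycleStarts

variable {ι : Type*} [Fintype ι] [LinearOrder ι] {σ τ : Perm ι} {α : Finset ι} {j s x : ι}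

/-- The starting points of all cycles of `σ` in `α` in the left-ordered notation: the least
elements of these cycles, in increasing order. -/
def cycleMins (σ : Perm ι) (α : Finset ι) : List ι :=
  {x ∈ α | ∀ y, σ.SameCycle x y → x ≤ y}.sort (· ≤ ·)

/-- The starting points, after `j`, of the cycles of `σ` in `α` in the left-ordered notation with
respect to `j`: the least elements of the cycles avoiding `j`, in increasing order. -/
def otherCycleMins (σ : Perm ι) (α : Finset ι) (j : ι) : List ι :=
  {x ∈ α | ¬ σ.SameCycle j x ∧ ∀ y, σ.SameCycle x y → x ≤ y}.sort (· ≤ ·)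

lemma not_sameCycle_of_mem_otherCycleMins (hx : x ∈ otherCycleMins σ α j) :
    ¬ σ.SameCycle j x := by
  rw [otherCycleMins, mem_sort] at hx
  exact (mem_filter.1 hx).2.1

lemma length_otherCycleMins_lt (hj : j ∈ α) : (otherCycleMins σ α j).length < #α := by
  rw [otherCycleMins, length_sort]
  exact card_lt_card (filter_ssubset.2 ⟨j, hj, fun h => h.1 (Perm.SameCycle.refl _ _)⟩)

lemma map_val_cycleStarts (τ : Perm α) (i : α) :
    (cycleStarts τ i).map Subtype.val = (i : ι) :: otherCycleMins (Perm.ofSubtype τ) α i := by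
  rw [cycleStarts, otherCycleMins, List.map_cons]
  congr 1
  refine (map_sort (Embedding.subtype (· ∈ α)) _ (· ≤ ·) (· ≤ ·) (by simp)).trans ?_
  congr 1
  ext x
  simp only [mem_map, mem_filter, mem_univ, true_and, Embedding.subtype_apply]
  constructor
  · rintro ⟨x, ⟨hx, hmin⟩, rfl⟩
    refine ⟨x.2, by rwa [sameCycle_ofSubtype], fun y hy => ?_⟩
    have hyα : y ∈ α := mem_of_sameCycle_of_mapsTo
      (mapsTo_of_mem_permsOfFinset (ofSubtype_mem_permsOfFinset τ)) x.2 hy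
    exact hmin ⟨y, hyα⟩ ((sameCycle_ofSubtype τ x ⟨y, hyα⟩).1 hy)
  · rintro ⟨hxα, hx, hmin⟩
    refine ⟨⟨x, hxα⟩, ⟨fun h => hx ((sameCycle_ofSubtype τ i ⟨x, hxα⟩).2 h), fun y hy => ?_⟩, rfl⟩
    exact hmin y ((sameCycle_ofSubtype τ ⟨x, hxα⟩ y).2 hy)

lemma cycleMins_eq_cons (hα : α.Nonempty) (hσ : σ ∈ permsOfFinset α) :
    cycleMins σ α = α.min' hα :: otherCycleMins σ α (α.min' hα) := by
  rw [cycleMins, otherCycleMins, ← sort_insert]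
  · congr 1
    ext x
    simp only [mem_insert, mem_filter]
    constructor
    · rintro ⟨hx, hmin⟩
      by_cases hc : σ.SameCycle (α.min' hα) x
      · exact Or.inl (le_antisymm (hmin _ hc.symm) (α.min'_le x hx))
      · exact Or.inr ⟨hx, hc, hmin⟩
    · rintro (rfl | ⟨hx, -, hmin⟩)
      · exact ⟨α.min'_mem hα, fun y hy => α.min'_le y
          (mem_of_sameCycle_of_mapsTo (mapsTo_of_mem_permsOfFinset hσ) (α.min'_mem hα) hy)⟩
      · exact ⟨hx, hmin⟩
  · exact fun x hx => α.min'_le x (mem_filter.1 hx).1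
  · exact fun h => (mem_filter.1 h).2.1 (Perm.SameCycle.refl _ _)

lemma otherCycleMins_of_apply_eq (hj : σ j = j) :
    otherCycleMins σ α j = cycleMins σ (α.erase j) := by
  rw [otherCycleMins, cycleMins]
  congr 1
  ext x
  simp only [mem_filter, Perm.sameCycle_comm (x := j), sameCycle_right_iff_eq_of_apply_eq hj,
    mem_erase]
  tauto

lemma otherCycleMins_mul_swap (hs : τ s = s) :
    otherCycleMins (τ * swap j s) α j = otherCycleMins τ (α.erase s) j := by
  rw [otherCycleMins, otherCycleMins]
  congr 1
  ext x
  by_cases hx : (τ * swap j s).SameCycle j x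
  · have := (sameCycle_mul_swap hs).1 hx
    simp only [mem_filter, mem_erase]
    tauto
  · have := mt (sameCycle_mul_swap hs).2 hx
    simp only [mem_filter, mem_erase,
      sameCycle_congr (mul_swap_pow_apply_of_not_sameCycle hs hx)]
    tauto

end CycleStarts

section CycleProducts

variable {ι R : Type*} [Ring R]

lemma cycleProd_congr [Finite ι] {M M' : Matrix ι ι R} {σ τ : Perm ι} {x : ι}
    (h : ∀ t : ℕ, (σ ^ t) x = (τ ^ t) x) (hM : ∀ y, σ.SameCycle x y → M y = M' y) :
    cycleProd M σ x = cycleProd M' τ x := by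
  rw [cycleProd, cycleProd, minimalPeriod_congr (τ := τ) (y := x) fun t => by rw [h]]
  congr 1
  refine List.map_congr_left fun t _ => ?_
  rw [hM _ (sameCycle_iff_exists_nat_pow_eq.2 ⟨t, rfl⟩), h, h]

lemma cycleProd_principalSub [DecidableEq ι] (M : Matrix ι ι R) {α : Finset ι} (τ : Perm α)
    (x : α) : cycleProd (principalSub M α) τ x = cycleProd M (Perm.ofSubtype τ) x := by
  have hper : minimalPeriod τ x = minimalPeriod (Perm.ofSubtype τ) (x : ι) :=
    minimalPeriod_congr fun t => by rw [ofSubtype_pow_apply, Subtype.coe_inj]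
  rw [cycleProd, cycleProd, hper]
  simp only [ofSubtype_pow_apply, principalSub, Matrix.submatrix_apply]

lemma cycleProd_updateRow_of_apply_eq [DecidableEq ι] (M : Matrix ι ι R) {σ : Perm ι} {j : ι}
    (hj : σ j = j) (b : ι → R) : cycleProd (M.updateRow j b) σ j = b j := by
  simp [cycleProd, minimalPeriod_eq_one_iff_isFixedPt.2 hj, hj]

lemma cycleProd_mul_swap [Finite ι] [DecidableEq ι] (M : Matrix ι ι R) (b : ι → R)
    {τ : Perm ι} {j s : ι} (hs : τ s = s) (hsj : s ≠ j) :
    cycleProd (M.updateRow j b) (τ * swap j s) j =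
      b s * cycleProd (M.updateRow j (M s)) τ j := by
  rw [cycleProd, cycleProd, minimalPeriod_mul_swap hs hsj, List.range_succ_eq_map, List.map_cons,
    List.prod_cons, List.map_map]
  congr 1
  · rw [zero_add, pow_one, mul_swap_apply_left hs, pow_zero, Perm.one_apply,
      Matrix.updateRow_self]
  congr 1
  refine List.map_congr_left fun t ht => ?_
  rw [List.mem_range] at ht
  rw [comp_apply, Nat.succ_eq_add_one, mul_swap_pow_succ_apply_left hs hsj (Nat.succ_pos t) ht]
  obtain rfl | ht₀ := t.eq_zero_or_pos
  · rw [zero_add, pow_one, mul_swap_apply_left hs, Matrix.updateRow_ne hsj, pow_zero,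
      Perm.one_apply, Matrix.updateRow_self]
  · have hne : (τ ^ t) j ≠ j := fun h => (minimalPeriod_le_of_pow_apply_eq ht₀ h).not_gt ht
    rw [mul_swap_pow_succ_apply_left hs hsj ht₀ ht.le, Matrix.updateRow_ne hne,
      Matrix.updateRow_ne hne]

/-- The term of `σ` in a row determinant of order `n`, where `L` lists the starting points of the
cycles of `σ`. -/
noncomputable def cycleTerm (M : Matrix ι ι R) (n : ℕ) (σ : Perm ι) (L : List ι) : R :=
  (-1) ^ (n - L.length) * (L.map (cycleProd M σ)).prod

lemma cycleTerm_principalSub [DecidableEq ι] (M : Matrix ι ι R) {α : Finset ι} (n : ℕ) (τ : Perm α)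
    (L : List α) :
    cycleTerm (principalSub M α) n τ L = cycleTerm M n (Perm.ofSubtype τ) (L.map Subtype.val) := by
  rw [cycleTerm, cycleTerm, List.length_map, List.map_map]
  congr 3
  exact funext (cycleProd_principalSub M τ)

lemma coe_min'_univ [LinearOrder ι] {α : Finset ι} (h : α.Nonempty)
    (h' : (univ : Finset α).Nonempty) :
    ((univ.min' h' : α) : ι) = α.min' h :=
  le_antisymm (min'_le univ (⟨α.min' h, α.min'_mem h⟩ : α) (mem_univ _))
    (α.min'_le _ (univ.min' h').2)

lemma hermDet_principalSub_empty [LinearOrder ι] (M : Matrix ι ι R) :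
    hermDet (principalSub M ∅) = 1 :=
  dif_neg (by simp)

end CycleProducts

section RowExpansion

variable {ι R : Type*} [Fintype ι] [LinearOrder ι] [Ring R]

/-- The `j`-th row determinant of the principal submatrix indexed by `α`, as a sum over
permutations of the whole index type that fix every point outside `α`. The value is a row
determinant only for `j ∈ α`. -/
noncomputable def rowDetOn (M : Matrix ι ι R) (α : Finset ι) (j : ι) : R :=
  ∑ σ ∈ permsOfFinset α, cycleTerm M #α σ (j :: otherCycleMins σ α j)

/-- The `(s, t)` entry of the adjugate of the principal submatrix indexed by `α`: the coefficient
of the `s`-th entry in the expansion of the `t`-th row determinant along its row `t`. -/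
noncomputable def adjugateOn (M : Matrix ι ι R) (α : Finset ι) (s t : ι) : R :=
  if s = t then hermDet (principalSub M (α.erase t))
  else -rowDetOn (M.updateRow t (M s)) (α.erase s) t

lemma rdet_principalSub (M : Matrix ι ι R) (α : Finset ι) (j : α) :
    rdet (principalSub M α) j = rowDetOn M α j := by
  rw [rowDetOn, ← sum_perm_subtype]
  refine sum_congr rfl fun τ _ => ?_
  rw [← map_val_cycleStarts, ← cycleTerm_principalSub, cycleTerm, Fintype.card_coe]

lemma hermDet_principalSub_of_nonempty (M : Matrix ι ι R) {α : Finset ι} (hα : α.Nonempty) :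
    hermDet (principalSub M α) = rowDetOn M α (α.min' hα) := by
  have h : (univ : Finset α).Nonempty := univ_nonempty_iff.2 hα.to_subtype
  rw [hermDet, dif_pos h, rdet_principalSub, coe_min'_univ hα h]

lemma hermDet_principalSub_eq_sum (M : Matrix ι ι R) (α : Finset ι) :
    hermDet (principalSub M α) = ∑ σ ∈ permsOfFinset α, cycleTerm M #α σ (cycleMins σ α) := by
  obtain rfl | hα := α.eq_empty_or_nonempty
  · have hperms : permsOfFinset (∅ : Finset ι) = {1} := by
      ext σ
      simp [mem_permsOfFinset_iff_forall_notMem, Perm.ext_iff]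
    simp [hermDet_principalSub_empty, hperms, cycleTerm, cycleMins]
  · rw [hermDet_principalSub_of_nonempty M hα]
    exact sum_congr rfl fun σ hσ => by rw [cycleMins_eq_cons hα hσ]

lemma map_cycleProd_otherCycleMins_congr {M M' : Matrix ι ι R} {σ τ : Perm ι} {α : Finset ι}
    {j : ι} (h : ∀ x, ¬ σ.SameCycle j x → ∀ t : ℕ, (σ ^ t) x = (τ ^ t) x)
    (hM : ∀ x ≠ j, M x = M' x) :
    (otherCycleMins σ α j).map (cycleProd M σ) = (otherCycleMins σ α j).map (cycleProd M' τ) := by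
  refine List.map_congr_left fun x hx => ?_
  have hjx := not_sameCycle_of_mem_otherCycleMins hx
  refine cycleProd_congr (h x hjx) fun y hxy => hM y ?_
  rintro rfl
  exact hjx hxy.symm

lemma neg_one_pow_mul_left_comm (n : ℕ) (a b : R) : (-1) ^ n * (a * b) = a * ((-1) ^ n * b) :=
  ((Commute.neg_one_left a).pow_left n).left_comm b

lemma cycleTerm_updateRow_of_apply_eq (M : Matrix ι ι R) {α : Finset ι} {σ : Perm ι} {j : ι}
    (hjα : j ∈ α) (hj : σ j = j) (b : ι → R) :
    cycleTerm (M.updateRow j b) #α σ (j :: otherCycleMins σ α j) =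
      b j * cycleTerm M #(α.erase j) σ (cycleMins σ (α.erase j)) := by
  have hlen : #α - ((cycleMins σ (α.erase j)).length + 1) =
      #(α.erase j) - (cycleMins σ (α.erase j)).length := by
    rw [card_erase_of_mem hjα]
    omega
  rw [cycleTerm, cycleTerm, List.map_cons, List.prod_cons, List.length_cons,
    cycleProd_updateRow_of_apply_eq M hj, neg_one_pow_mul_left_comm,
    map_cycleProd_otherCycleMins_congr (M' := M) (τ := σ) (fun _ _ _ => rfl)
      (fun x hx => funext fun _ => by rw [Matrix.updateRow_ne hx]),
    otherCycleMins_of_apply_eq hj, hlen]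

lemma cycleTerm_updateRow_mul_swap (M : Matrix ι ι R) {α : Finset ι} {τ : Perm ι} {j s : ι}
    (hjα : j ∈ α) (hsα : s ∈ α) (hs : τ s = s) (hsj : s ≠ j) (b : ι → R) :
    cycleTerm (M.updateRow j b) #α (τ * swap j s) (j :: otherCycleMins (τ * swap j s) α j) =
      b s * -cycleTerm (M.updateRow j (M s)) #(α.erase s) τ
        (j :: otherCycleMins τ (α.erase s) j) := by
  have hlt : (otherCycleMins τ (α.erase s) j).length < #(α.erase s) :=
    length_otherCycleMins_lt (mem_erase.2 ⟨hsj.symm, hjα⟩)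
  have hlen : #α - ((otherCycleMins τ (α.erase s) j).length + 1) =
      #(α.erase s) - ((otherCycleMins τ (α.erase s) j).length + 1) + 1 := by
    rw [card_erase_of_mem hsα] at hlt ⊢
    omega
  rw [cycleTerm, cycleTerm, List.map_cons, List.prod_cons, List.map_cons, List.prod_cons,
    List.length_cons, List.length_cons, map_cycleProd_otherCycleMins_congr
      (M' := M.updateRow j (M s)) (τ := τ) (fun x => mul_swap_pow_apply_of_not_sameCycle hs)
      (fun x hx => funext fun _ => by rw [Matrix.updateRow_ne hx, Matrix.updateRow_ne hx]),
    cycleProd_mul_swap M b hs hsj, otherCycleMins_mul_swap hs, hlen, mul_assoc (b s),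
    neg_one_pow_mul_left_comm, pow_succ, mul_neg_one, neg_mul]

theorem rowDetOn_updateRow (M : Matrix ι ι R) {α : Finset ι} {j : ι} (hj : j ∈ α) (b : ι → R) :
    rowDetOn (M.updateRow j b) α j = ∑ s ∈ α, b s * adjugateOn M α s j := by
  rw [rowDetOn, ← sum_fiberwise_of_maps_to (g := fun σ => σ j)
    fun σ hσ => mapsTo_of_mem_permsOfFinset hσ hj]
  refine sum_congr rfl fun s hs => ?_
  obtain rfl | hsj := eq_or_ne s j
  · rw [filter_permsOfFinset_apply_eq_self, adjugateOn, if_pos rfl, hermDet_principalSub_eq_sum,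
      mul_sum]
    exact sum_congr rfl fun σ hσ => cycleTerm_updateRow_of_apply_eq M hs
      (mem_permsOfFinset_iff_forall_notMem.1 hσ s (notMem_erase s α)) b
  · rw [filter_permsOfFinset_apply_eq hj hs, sum_map, adjugateOn, if_neg hsj, rowDetOn,
      ← sum_neg_distrib, mul_sum]
    exact sum_congr rfl fun τ hτ => cycleTerm_updateRow_mul_swap M hj hs
      (mem_permsOfFinset_iff_forall_notMem.1 hτ s (notMem_erase s α)) hsj b

lemma rowDetOn_eq_sum (M : Matrix ι ι R) {α : Finset ι} {j : ι} (hj : j ∈ α) :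
    rowDetOn M α j = ∑ s ∈ α, M j s * adjugateOn M α s j := by
  rw [← rowDetOn_updateRow M hj, Matrix.updateRow_eq_self]

lemma adjugateOn_self (M : Matrix ι ι R) (α : Finset ι) (t : ι) :
    adjugateOn M α t t = hermDet (principalSub M (α.erase t)) := if_pos rfl

lemma adjugateOn_of_ne (M : Matrix ι ι R) {α : Finset ι} {s t : ι} (ht : t ∈ α) (hst : s ≠ t) :
    adjugateOn M α s t = -∑ u ∈ α.erase s, M s u * adjugateOn M (α.erase s) u t := by
  rw [adjugateOn, if_neg hst, rowDetOn_updateRow M (mem_erase.2 ⟨hst.symm, ht⟩)]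

lemma sum_adjugateOn_mul_eq_sub (M : Matrix ι ι R) {α : Finset ι} {t : ι} (ht : t ∈ α)
    (u : ι) :
    ∑ s ∈ α, adjugateOn M α t s * M s u = hermDet (principalSub M (α.erase t)) * M t u -
      ∑ v ∈ α.erase t, M t v * ∑ s ∈ α.erase t, adjugateOn M (α.erase t) v s * M s u := by
  rw [← add_sum_erase _ _ ht, adjugateOn_self, sub_eq_add_neg]
  congr 1
  simp only [mul_sum]
  rw [sum_comm, ← sum_neg_distrib]
  refine sum_congr rfl fun s hs => ?_
  obtain ⟨hst, hs'⟩ := mem_erase.1 hs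
  rw [adjugateOn_of_ne M hs' hst.symm, neg_mul, sum_mul]
  simp only [mul_assoc]

end RowExpansion

section LaplaceExpansion

/-- Self-adjoint elements are central: the property of the quaternions that makes determinants of
Hermitian matrices well-behaved. -/
class HasCentralSelfAdjoints (R : Type*) [Ring R] [StarRing R] : Prop where
  commute_of_isSelfAdjoint {x : R} (hx : IsSelfAdjoint x) (y : R) : Commute x y

open HasCentralSelfAdjoints (commute_of_isSelfAdjoint)

instance {S : Type*} [CommRing S] [NoZeroDivisors S] [CharZero S] :
    HasCentralSelfAdjoints ℍ[S] where
  commute_of_isSelfAdjoint hx y := by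
    rw [Quaternion.star_eq_self.1 hx]
    exact Quaternion.coe_commutes _ y

variable {ι R : Type*} [Fintype ι] [LinearOrder ι] [Ring R] [StarRing R]

/-- The Laplace expansion for the principal submatrix indexed by `α`: the matrix `adjugateOn M α`
is Hermitian and is a left adjugate of that submatrix, whose determinant is self-adjoint. -/
structure HasLaplaceExpansion (M : Matrix ι ι R) (α : Finset ι) : Prop where
  star_adjugateOn : ∀ s ∈ α, ∀ t ∈ α, star (adjugateOn M α s t) = adjugateOn M α t s
  sum_adjugateOn_mul : ∀ t ∈ α, ∀ u ∈ α,
    ∑ s ∈ α, adjugateOn M α t s * M s u = if t = u then hermDet (principalSub M α) else 0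
  isSelfAdjoint_hermDet : IsSelfAdjoint (hermDet (principalSub M α))

variable {M : Matrix ι ι R} {α : Finset ι}

lemma adjugateOn_eq_sum_sum (hM : M.IsHermitian) (ih : ∀ β ⊂ α, HasLaplaceExpansion M β) {s t : ι}
    (hs : s ∈ α) (ht : t ∈ α) (hst : s ≠ t) :
    adjugateOn M α s t = -(M s t * hermDet (principalSub M ((α.erase s).erase t))) +
      ∑ u ∈ (α.erase s).erase t, ∑ v ∈ (α.erase s).erase t,
        M s u * adjugateOn M ((α.erase s).erase t) u v * M v t := by
  have ht' : t ∈ α.erase s := mem_erase.2 ⟨hst.symm, ht⟩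
  have ih_s := ih _ (erase_ssubset hs)
  have ih_st := ih _ ((erase_ssubset ht').trans (erase_ssubset hs))
  rw [adjugateOn_of_ne M ht hst, ← add_sum_erase _ _ ht', adjugateOn_self, neg_add,
    ← sum_neg_distrib]
  congr 1
  refine sum_congr rfl fun u hu => ?_
  obtain ⟨hut, hu'⟩ := mem_erase.1 hu
  rw [← ih_s.star_adjugateOn t ht' u hu', adjugateOn_of_ne M hu' hut.symm, star_neg, star_sum,
    mul_neg, neg_neg, mul_sum]
  refine sum_congr rfl fun v hv => ?_
  rw [star_mul, ih_st.star_adjugateOn v hv u hu, hM.apply, mul_assoc]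

section Induction

variable [HasCentralSelfAdjoints R] {s t u : ι}

lemma star_adjugateOn_of_forall_ssubset (hM : M.IsHermitian)
    (ih : ∀ β ⊂ α, HasLaplaceExpansion M β) (hs : s ∈ α) (ht : t ∈ α) :
    star (adjugateOn M α s t) = adjugateOn M α t s := by
  obtain rfl | hst := eq_or_ne s t
  · rw [adjugateOn_self, (ih _ (erase_ssubset hs)).isSelfAdjoint_hermDet.star_eq]
  have ht' : t ∈ α.erase s := mem_erase.2 ⟨hst.symm, ht⟩
  have ih_st := ih _ ((erase_ssubset ht').trans (erase_ssubset hs))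
  rw [adjugateOn_eq_sum_sum hM ih hs ht hst, adjugateOn_eq_sum_sum hM ih ht hs hst.symm,
    erase_right_comm (a := t) (b := s), star_add, star_neg, star_mul,
    ih_st.isSelfAdjoint_hermDet.star_eq, hM.apply,
    (commute_of_isSelfAdjoint ih_st.isSelfAdjoint_hermDet _).eq, star_sum, sum_comm]
  congr 1
  refine sum_congr rfl fun u hu => ?_
  rw [star_sum]
  refine sum_congr rfl fun v hv => ?_
  rw [star_mul, star_mul, hM.apply, hM.apply, ih_st.star_adjugateOn u hu v hv, mul_assoc]

lemma sum_adjugateOn_mul_of_ne (ih : ∀ β ⊂ α, HasLaplaceExpansion M β) (ht : t ∈ α) (hu : u ∈ α)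
    (htu : t ≠ u) : ∑ s ∈ α, adjugateOn M α t s * M s u = 0 := by
  have ih_t := ih _ (erase_ssubset ht)
  have hu' : u ∈ α.erase t := mem_erase.2 ⟨htu.symm, hu⟩
  rw [sum_adjugateOn_mul_eq_sub M ht,
    sum_congr rfl fun v hv => by rw [ih_t.sum_adjugateOn_mul v hv u hu'],
    (commute_of_isSelfAdjoint ih_t.isSelfAdjoint_hermDet _).eq]
  simp only [mul_ite, mul_zero, sum_ite_eq', hu', if_true, sub_self]

lemma isSelfAdjoint_sum_adjugateOn_mul (hM : M.IsHermitian)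
    (ih : ∀ β ⊂ α, HasLaplaceExpansion M β) (ht : t ∈ α) :
    IsSelfAdjoint (∑ s ∈ α, adjugateOn M α t s * M s t) := by
  have ih_t := ih _ (erase_ssubset ht)
  rw [IsSelfAdjoint, sum_adjugateOn_mul_eq_sub M ht, star_sub, star_mul, hM.apply,
    ih_t.isSelfAdjoint_hermDet.star_eq,
    (commute_of_isSelfAdjoint ih_t.isSelfAdjoint_hermDet _).eq, star_sum]
  congr 1
  simp only [mul_sum, star_sum]
  rw [sum_comm]
  refine sum_congr rfl fun u hu => sum_congr rfl fun v hv => ?_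
  rw [star_mul, star_mul, hM.apply, hM.apply, ih_t.star_adjugateOn v hv u hu, mul_assoc]

lemma star_sum_adjugateOn_mul (hM : M.IsHermitian) (ih : ∀ β ⊂ α, HasLaplaceExpansion M β)
    (ht : t ∈ α) :
    star (∑ s ∈ α, adjugateOn M α t s * M s u) = ∑ s ∈ α, M u s * adjugateOn M α s t := by
  rw [star_sum]
  exact sum_congr rfl fun s hs => by
    rw [star_mul, hM.apply, star_adjugateOn_of_forall_ssubset hM ih ht hs]

lemma sum_adjugateOn_mul_self (hM : M.IsHermitian) (ih : ∀ β ⊂ α, HasLaplaceExpansion M β)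
    (ht : t ∈ α) : ∑ s ∈ α, adjugateOn M α t s * M s t = rowDetOn M α t := by
  rw [rowDetOn_eq_sum M ht, ← star_sum_adjugateOn_mul hM ih ht,
    (isSelfAdjoint_sum_adjugateOn_mul hM ih ht).star_eq]

lemma isSelfAdjoint_rowDetOn (hM : M.IsHermitian) (ih : ∀ β ⊂ α, HasLaplaceExpansion M β)
    (ht : t ∈ α) : IsSelfAdjoint (rowDetOn M α t) :=
  sum_adjugateOn_mul_self hM ih ht ▸ isSelfAdjoint_sum_adjugateOn_mul hM ih ht

lemma sum_mul_adjugateOn_eq_rowDetOn (hM : M.IsHermitian)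
    (ih : ∀ β ⊂ α, HasLaplaceExpansion M β) (hs : s ∈ α) (ht : t ∈ α) :
    ∑ u ∈ α, M s u * adjugateOn M α u t = if s = t then rowDetOn M α s else 0 := by
  split_ifs with hst
  · rw [← hst, rowDetOn_eq_sum M hs]
  · rw [← star_sum_adjugateOn_mul hM ih ht, sum_adjugateOn_mul_of_ne ih ht hs (Ne.symm hst),
      star_zero]

lemma rowDetOn_eq_of_apply_ne_zero [NoZeroDivisors R] (hM : M.IsHermitian)
    (ih : ∀ β ⊂ α, HasLaplaceExpansion M β) (hs : s ∈ α) (ht : t ∈ α) (hst : M s t ≠ 0) :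
    rowDetOn M α s = rowDetOn M α t := by
  -- The `(s, t)` entry of `M * adj M * M` can be computed in two ways.
  have h_left : ∑ v ∈ α, (∑ u ∈ α, M s u * adjugateOn M α u v) * M v t =
      rowDetOn M α s * M s t := by
    rw [sum_congr rfl fun v hv => by rw [sum_mul_adjugateOn_eq_rowDetOn hM ih hs hv]]
    simp only [ite_mul, zero_mul, sum_ite_eq, hs, if_true]
  have h_right : ∑ u ∈ α, M s u * (∑ v ∈ α, adjugateOn M α u v * M v t) =
      M s t * rowDetOn M α t := by
    rw [← add_sum_erase _ _ ht, sum_adjugateOn_mul_self hM ih ht, add_eq_left]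
    refine sum_eq_zero fun u hu => ?_
    obtain ⟨hut, hu'⟩ := mem_erase.1 hu
    rw [sum_adjugateOn_mul_of_ne ih hu' ht hut, mul_zero]
  have h_assoc : ∑ v ∈ α, (∑ u ∈ α, M s u * adjugateOn M α u v) * M v t =
      ∑ u ∈ α, M s u * (∑ v ∈ α, adjugateOn M α u v * M v t) := by
    simp only [sum_mul, mul_sum, mul_assoc]
    exact sum_comm
  rw [h_left, h_right, ← (commute_of_isSelfAdjoint (isSelfAdjoint_rowDetOn hM ih ht) _).eq]
    at h_assoc
  exact mul_right_cancel₀ hst h_assoc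

end Induction

end LaplaceExpansion

section HermitianDeterminant

variable {ι : Type*} [Fintype ι] [LinearOrder ι] {M : Matrix ι ι ℍ[ℝ]} {α : Finset ι}

lemma conjTranspose_real_smul {κ l : Type*} (c : ℝ) (A : Matrix κ l ℍ[ℝ]) : (c • A)ᴴ = c • Aᴴ :=
  Matrix.ext fun _ _ => Quaternion.star_smul c _

lemma continuous_rowDetOn {R : Type*} [Ring R] [TopologicalSpace R] [IsTopologicalRing R]
    (α : Finset ι) (t : ι) : Continuous fun M : Matrix ι ι R => rowDetOn M α t := by
  have continuous_cycleProd (σ : Perm ι) (x : ι) :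
      Continuous fun M : Matrix ι ι R => cycleProd M σ x :=
    continuous_list_prod _ fun _ _ => continuous_id.matrix_elem _ _
  exact continuous_finsetSum _ fun σ _ => continuous_const.mul
    (continuous_list_prod _ fun x _ => continuous_cycleProd σ x)

lemma rowDetOn_eq_rowDetOn (ih : ∀ β ⊂ α, ∀ M : Matrix ι ι ℍ[ℝ], M.IsHermitian →
    HasLaplaceExpansion M β) (hM : M.IsHermitian) {s t : ι} (hs : s ∈ α) (ht : t ∈ α) :
    rowDetOn M α s = rowDetOn M α t := by
  obtain rfl | hst := eq_or_ne s t
  · rfl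
  by_cases h₀ : M s t = 0
  swap
  · exact rowDetOn_eq_of_apply_ne_zero hM (fun β hβ => ih β hβ M hM) hs ht h₀
  let E : ℝ → Matrix ι ι ℍ[ℝ] := fun ε => M + ε • (Matrix.single s t 1 + Matrix.single t s 1)
  have isHermitian_E (ε : ℝ) : (E ε).IsHermitian := by
    change (M + ε • _)ᴴ = _
    rw [Matrix.conjTranspose_add, conjTranspose_real_smul, Matrix.conjTranspose_add,
      Matrix.conjTranspose_single, Matrix.conjTranspose_single, star_one, hM.eq,
      add_comm (Matrix.single t s _)]
  have E_apply_ne_zero {ε : ℝ} (hε : ε ≠ 0) : E ε s t ≠ 0 := by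
    simp [E, h₀, hst.symm, hε]
  have continuous_E : Continuous E := by fun_prop
  have hE : (fun ε => rowDetOn (E ε) α s) = fun ε => rowDetOn (E ε) α t :=
    Continuous.ext_on (dense_compl_singleton 0) ((continuous_rowDetOn α s).comp continuous_E)
      ((continuous_rowDetOn α t).comp continuous_E) fun ε hε =>
        rowDetOn_eq_of_apply_ne_zero (isHermitian_E ε) (fun β hβ => ih β hβ _ (isHermitian_E ε))
          hs ht (E_apply_ne_zero hε)
  simpa [E] using congrFun hE 0

theorem hasLaplaceExpansion (hM : M.IsHermitian) (α : Finset ι) : HasLaplaceExpansion M α := by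
  induction α using Finset.strongInduction generalizing M with
  | H α ih =>
    have ihM : ∀ β ⊂ α, HasLaplaceExpansion M β := fun β hβ => ih β hβ hM
    have hdet : ∀ t ∈ α, hermDet (principalSub M α) = rowDetOn M α t := fun t ht => by
      rw [hermDet_principalSub_of_nonempty M ⟨t, ht⟩]
      exact rowDetOn_eq_rowDetOn (fun β hβ _ => ih β hβ) hM (min'_mem _ _) ht
    refine ⟨fun s hs t ht => star_adjugateOn_of_forall_ssubset hM ihM hs ht,
      fun t ht u hu => ?_, ?_⟩
    · split_ifs with htu
      · rw [← htu, hdet t ht, sum_adjugateOn_mul_self hM ihM ht]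
      · exact sum_adjugateOn_mul_of_ne ihM ht hu htu
    · obtain rfl | ⟨t, ht⟩ := α.eq_empty_or_nonempty
      · rw [hermDet_principalSub_empty]
        exact IsSelfAdjoint.one _
      · rw [hdet t ht]
        exact isSelfAdjoint_rowDetOn hM ihM ht

lemma sum_mul_adjugateOn (hM : M.IsHermitian) {s t : ι} (hs : s ∈ α) (ht : t ∈ α) :
    ∑ u ∈ α, M s u * adjugateOn M α u t = if s = t then hermDet (principalSub M α) else 0 := by
  have h := hasLaplaceExpansion hM α
  rw [← star_sum_adjugateOn_mul hM (fun β _ => hasLaplaceExpansion hM β) ht,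
    h.sum_adjugateOn_mul t ht s hs]
  simp only [eq_comm (a := t), apply_ite star, h.isSelfAdjoint_hermDet.star_eq, star_zero]

end HermitianDeterminant

section MinorSums

variable {ι R : Type*} [Fintype ι] [LinearOrder ι] [Ring R]

/-- The matrix of the map that sends a row `b` to the row of the sums `rowMinorSum M k j b`; up to
sign, it is the `k`-th coefficient of the adjugate of `x - M`. -/
noncomputable def adjugateSum (M : Matrix ι ι R) (k : ℕ) : Matrix ι ι R :=
  Matrix.of fun s j => ∑ α ∈ powersetCard k univ, if s ∈ α ∧ j ∈ α then adjugateOn M α s j else 0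

lemma adjugateSum_apply (M : Matrix ι ι R) (k : ℕ) (s j : ι) : adjugateSum M k s j =
    ∑ α ∈ powersetCard k univ, if s ∈ α ∧ j ∈ α then adjugateOn M α s j else 0 := rfl

lemma sum_mul_adjugateSum (M : Matrix ι ι R) (k : ℕ) (b : ι → R) (j : ι) :
    ∑ s, b s * adjugateSum M k s j = ∑ α ∈ powersetCard k univ,
      if j ∈ α then ∑ s ∈ α, b s * adjugateOn M α s j else 0 := by
  simp only [adjugateSum_apply, mul_sum]
  rw [sum_comm]
  refine sum_congr rfl fun α _ => ?_
  split_ifs with hj <;> simp [hj, sum_ite_mem]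

theorem rowMinorSum_eq_sum (M : Matrix ι ι R) (k : ℕ) (j : ι) (b : ι → R) :
    rowMinorSum M k j b = ∑ s, b s * adjugateSum M k s j := by
  rw [sum_mul_adjugateSum, ← sum_filter, rowMinorSum,
    sum_subtype ({α ∈ powersetCard k univ | j ∈ α}) (p := fun α : Finset ι => #α = k ∧ j ∈ α)
      (by simp)]
  exact sum_congr rfl fun α _ => by rw [rdet_principalSub, rowDetOn_updateRow M α.2.2 b]

lemma minorSum_zero (M : Matrix ι ι R) : minorSum M 0 = 1 := by
  rw [minorSum, powersetCard_zero, sum_singleton, hermDet_principalSub_empty]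

lemma minorSum_of_card_lt (M : Matrix ι ι R) {k : ℕ} (hk : Fintype.card ι < k) :
    minorSum M k = 0 := by
  rw [minorSum, powersetCard_eq_empty.2 (by rwa [card_univ]), sum_empty]

lemma adjugateSum_of_card_lt (M : Matrix ι ι R) {k : ℕ} (hk : Fintype.card ι < k) :
    adjugateSum M k = 0 := by
  ext s j
  rw [adjugateSum_apply, powersetCard_eq_empty.2 (by rwa [card_univ]), sum_empty,
    Matrix.zero_apply]

lemma adjugateSum_zero (M : Matrix ι ι R) : adjugateSum M 0 = 0 := by
  ext s j
  simp [adjugateSum_apply]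

lemma sum_powersetCard_succ_ite_mem {S : Type*} [AddCommMonoid S] (k : ℕ) (t : ι)
    (f : Finset ι → S) :
    (∑ β ∈ powersetCard (k + 1) univ, if t ∈ β then f β else 0) =
      ∑ α ∈ powersetCard k univ, if t ∉ α then f (insert t α) else 0 := by
  rw [← sum_filter, ← sum_filter]
  refine sum_nbij' (erase · t) (insert t) ?_ ?_ ?_ ?_ ?_
  · intro β hβ
    rw [mem_filter, mem_powersetCard_univ] at hβ ⊢
    rw [card_erase_of_mem hβ.2, hβ.1]
    exact ⟨rfl, notMem_erase t β⟩
  · intro α hα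
    rw [mem_filter, mem_powersetCard_univ] at hα ⊢
    rw [card_insert_of_notMem hα.2, hα.1]
    exact ⟨rfl, mem_insert_self t α⟩
  · exact fun β hβ => insert_erase (mem_filter.1 hβ).2
  · exact fun α hα => erase_insert (mem_filter.1 hα).2
  · exact fun β hβ => by rw [insert_erase (mem_filter.1 hβ).2]

lemma adjugateSum_succ_apply (M : Matrix ι ι R) (k : ℕ) (t j : ι) :
    adjugateSum M (k + 1) t j = ∑ α ∈ powersetCard k univ,
      if t ∉ α then (if j ∈ insert t α then adjugateOn M (insert t α) t j else 0) else 0 := by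
  rw [adjugateSum_apply, ← sum_powersetCard_succ_ite_mem k t
    (fun β => if j ∈ β then adjugateOn M β t j else 0)]
  simp only [ite_and]

lemma adjugateSum_succ_apply_self (M : Matrix ι ι R) (k : ℕ) (t : ι) :
    adjugateSum M (k + 1) t t =
      ∑ α ∈ powersetCard k univ, if t ∉ α then hermDet (principalSub M α) else 0 := by
  rw [adjugateSum_succ_apply]
  refine sum_congr rfl fun α _ => ?_
  by_cases ht : t ∈ α
  · simp [ht]
  · rw [if_pos ht, if_pos (mem_insert_self t α), if_pos ht, adjugateOn_self, erase_insert ht]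

lemma trace_adjugateSum_succ (M : Matrix ι ι R) (k : ℕ) :
    (adjugateSum M (k + 1)).trace = (Fintype.card ι - k) • minorSum M k := by
  simp only [Matrix.trace, Matrix.diag_apply, adjugateSum_succ_apply_self]
  rw [sum_comm, minorSum, smul_sum]
  refine sum_congr rfl fun α hα => ?_
  rw [← sum_filter, sum_const, filter_notMem_eq_sdiff, ← compl_eq_univ_sdiff, card_compl,
    mem_powersetCard_univ.1 hα]

end MinorSums

section HermitianMinorSums

variable {ι : Type*} [Fintype ι] [LinearOrder ι] {M : Matrix ι ι ℍ[ℝ]}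

lemma minorSum_eq_coe_re (hM : M.IsHermitian) (k : ℕ) :
    minorSum M k = ((minorSum M k).re : ℍ[ℝ]) :=
  Quaternion.star_eq_self.1 <|
    isSelfAdjoint_sum _ fun α _ => (hasLaplaceExpansion hM α).isSelfAdjoint_hermDet

theorem adjugateSum_succ_add_mul (hM : M.IsHermitian) (k : ℕ) :
    adjugateSum M (k + 1) + M * adjugateSum M k = (minorSum M k).re • (1 : Matrix ι ι ℍ[ℝ]) := by
  ext1 t j
  rw [Matrix.add_apply, Matrix.mul_apply, sum_mul_adjugateSum, Matrix.smul_apply]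
  obtain rfl | htj := eq_or_ne t j
  · rw [adjugateSum_succ_apply_self, ← sum_add_distrib, Matrix.one_apply_eq,
      ← Quaternion.coe_mul_eq_smul, mul_one, ← minorSum_eq_coe_re hM, minorSum]
    refine sum_congr rfl fun α _ => ?_
    by_cases ht : t ∈ α
    · rw [if_neg (not_not.2 ht), if_pos ht, sum_mul_adjugateOn hM ht ht, if_pos rfl, zero_add]
    · rw [if_pos ht, if_neg ht, add_zero]
  · rw [adjugateSum_succ_apply, ← sum_add_distrib, Matrix.one_apply_ne htj, smul_zero]
    refine sum_eq_zero fun α _ => ?_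
    by_cases hj : j ∈ α
    · by_cases ht : t ∈ α
      · rw [if_neg (not_not.2 ht), if_pos hj, sum_mul_adjugateOn hM ht hj, if_neg htj, zero_add]
      · rw [if_pos ht, if_pos (mem_insert_of_mem hj), if_pos hj,
          adjugateOn_of_ne M (mem_insert_of_mem hj) htj, erase_insert ht, neg_add_cancel]
    · simp [hj, htj.symm]

lemma adjugateSum_succ (hM : M.IsHermitian) (k : ℕ) :
    adjugateSum M (k + 1) = (minorSum M k).re • (1 : Matrix ι ι ℍ[ℝ]) - M * adjugateSum M k :=
  eq_sub_of_add_eq (adjugateSum_succ_add_mul hM k)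

lemma commute_adjugateSum (hM : M.IsHermitian) (k : ℕ) : Commute M (adjugateSum M k) := by
  induction k with
  | zero => exact adjugateSum_zero M ▸ Commute.zero_right M
  | succ k ih =>
    rw [adjugateSum_succ hM]
    exact ((Commute.one_right M).smul_right _).sub_right ((Commute.refl M).mul_right ih)

lemma isHermitian_adjugateSum (hM : M.IsHermitian) (k : ℕ) : (adjugateSum M k).IsHermitian := by
  induction k with
  | zero => exact adjugateSum_zero M ▸ Matrix.isHermitian_zero
  | succ k ih =>
    change _ᴴ = _
    rw [adjugateSum_succ hM, Matrix.conjTranspose_sub, conjTranspose_real_smul,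
      Matrix.conjTranspose_one, Matrix.conjTranspose_mul, hM.eq, ih.eq,
      (commute_adjugateSum hM k).eq]

end HermitianMinorSums

section RightColumnSpace

variable {ι κ l R : Type*} [Fintype κ] [Ring R]

instance : Module.Finite Rᵐᵒᵖ R :=
  ⟨⟨{1}, eq_top_iff.2 fun x _ => by
    rw [coe_singleton, Submodule.mem_span_singleton]
    exact ⟨MulOpposite.op x, by simp⟩⟩⟩

/-- The right column space of a matrix: the submodule spanned by the columns for the multiplication
by scalars from the right. -/
def colSpace (A : Matrix ι κ R) : Submodule Rᵐᵒᵖ (ι → R) :=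
  Submodule.span Rᵐᵒᵖ (Set.range A.col)

lemma mem_colSpace {A : Matrix ι κ R} {x : ι → R} : x ∈ colSpace A ↔ ∃ y, A *ᵥ y = x := by
  rw [colSpace, Submodule.mem_span_range_iff_exists_fun]
  constructor
  · rintro ⟨c, rfl⟩
    exact ⟨fun i => (c i).unop, by ext k; simp [Matrix.mulVec, dotProduct]⟩
  · rintro ⟨y, rfl⟩
    exact ⟨fun i => MulOpposite.op (y i), by ext k; simp [Matrix.mulVec, dotProduct]⟩

lemma colSpace_mul_le (A : Matrix ι κ R) (B : Matrix κ l R) : colSpace (A * B) ≤ colSpace A := by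
  refine Submodule.span_le.2 ?_
  rintro _ ⟨j, rfl⟩
  exact mem_colSpace.2 ⟨B.col j, rfl⟩

lemma exists_eq_mul_of_colSpace_le {A : Matrix ι l R} {B : Matrix ι κ R}
    (h : colSpace A ≤ colSpace B) : ∃ Y : Matrix κ l R, A = B * Y := by
  choose y hy using fun k => mem_colSpace.1 (h (Submodule.subset_span (Set.mem_range_self k)))
  refine ⟨Matrix.of fun i k => y k i, ?_⟩
  ext i k
  exact (congrFun (hy k) i).symm

lemma mul_left_cancel_of_linearIndependent {C : Matrix ι κ R} {X Y : Matrix κ l R}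
    (hC : LinearIndependent Rᵐᵒᵖ C.col) (h : C * X = C * Y) : X = Y := by
  ext j k
  have hXY : ∑ j, MulOpposite.op (X j k) • C.col j = ∑ j, MulOpposite.op (Y j k) • C.col j := by
    ext i
    simpa [Matrix.mul_apply] using congrFun (congrFun h i) k
  exact MulOpposite.op_injective
    (Fintype.linearIndependent_iffₛ.1 hC _ _ hXY j)

theorem exists_rank_factorization {D : Type*} [DivisionRing D] {P : Matrix κ κ D}
    (hP : IsIdempotentElem P) :
    ∃ (C : Matrix κ (Fin (Module.finrank Dᵐᵒᵖ (colSpace P))) D)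
      (F : Matrix (Fin (Module.finrank Dᵐᵒᵖ (colSpace P))) κ D), C * F = P ∧ F * C = 1 := by
  obtain ⟨c, -, hspan, hli⟩ :=
    Submodule.exists_fun_fin_finrank_span_eq Dᵐᵒᵖ (Set.range P.col)
  let C : Matrix κ (Fin (Module.finrank Dᵐᵒᵖ (colSpace P))) D := Matrix.of fun i j => c j i
  have hC : colSpace C = colSpace P := hspan
  obtain ⟨F, hF⟩ := exists_eq_mul_of_colSpace_le hC.ge
  obtain ⟨Y, hY⟩ := exists_eq_mul_of_colSpace_le hC.le
  have hPC : P * C = C := by rw [hY, ← Matrix.mul_assoc, hP.eq]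
  refine ⟨C, F, hF.symm, mul_left_cancel_of_linearIndependent (C := C) hli ?_⟩
  rw [← Matrix.mul_assoc, ← hF, hPC, Matrix.mul_one]

end RightColumnSpace

section Definiteness

variable {ι κ l : Type*} [Fintype ι]

lemma re_sum (s : Finset κ) (f : κ → ℍ[ℝ]) : (∑ i ∈ s, f i).re = ∑ i ∈ s, (f i).re :=
  map_sum (QuaternionAlgebra.reₗ _ _ _) f s

lemma eq_zero_of_conjTranspose_mul_self {X : Matrix ι κ ℍ[ℝ]} (h : Xᴴ * X = 0) : X = 0 := by
  ext1 i j
  have hsum : ∑ i, Quaternion.normSq (X i j) = 0 := by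
    have hjj := congrArg (·.re) (congrFun (congrFun h j) j)
    simpa [Matrix.mul_apply, Quaternion.star_mul_self, re_sum] using hjj
  have hij := (sum_eq_zero_iff_of_nonneg fun i _ => Quaternion.normSq_nonneg).1 hsum i (mem_univ i)
  exact Quaternion.normSq_eq_zero.1 hij

lemma mul_eq_zero_of_conjTranspose_mul [Fintype κ] {A : Matrix ι κ ℍ[ℝ]} {X : Matrix κ l ℍ[ℝ]}
    (h : Aᴴ * (A * X) = 0) : A * X = 0 := by
  apply eq_zero_of_conjTranspose_mul_self
  rw [Matrix.conjTranspose_mul, Matrix.mul_assoc, h, Matrix.mul_zero]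

lemma mul_eq_zero_of_pow_succ_mul [DecidableEq ι] {M : Matrix ι ι ℍ[ℝ]} (hM : M.IsHermitian)
    {X : Matrix ι κ ℍ[ℝ]} {i : ℕ} (h : M ^ (i + 1) * X = 0) : M * X = 0 := by
  induction i generalizing X with
  | zero => simpa using h
  | succ i ih =>
    rw [pow_succ, Matrix.mul_assoc] at h
    apply mul_eq_zero_of_conjTranspose_mul
    rw [hM.eq, ih h]

end Definiteness

section Trace

variable {ι κ : Type*} [Fintype ι] [Fintype κ]

lemma re_mul_comm (a b : ℍ[ℝ]) : (a * b).re = (b * a).re := by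
  simp only [Quaternion.re_mul]
  ring

lemma re_trace_mul_comm (A : Matrix ι κ ℍ[ℝ]) (B : Matrix κ ι ℍ[ℝ]) :
    (A * B).trace.re = (B * A).trace.re := by
  simp only [Matrix.trace, Matrix.diag_apply, Matrix.mul_apply, re_sum]
  rw [sum_comm]
  simp only [re_mul_comm (A _ _)]

theorem re_trace_of_isIdempotentElem {P : Matrix ι ι ℍ[ℝ]} (hP : IsIdempotentElem P) :
    P.trace.re = Module.finrank ℍ[ℝ]ᵐᵒᵖ (colSpace P) := by
  obtain ⟨C, F, hCF, hFC⟩ := exists_rank_factorization hP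
  calc P.trace.re = (F * C).trace.re := by rw [← re_trace_mul_comm, hCF]
    _ = Module.finrank ℍ[ℝ]ᵐᵒᵖ (colSpace P) := by
      rw [hFC, Matrix.trace_one, Fintype.card_fin, Quaternion.re_natCast]

end Trace

section Rank

variable {m n l : ℕ}

lemma rk_mul_le (A : Matrix (Fin m) (Fin n) ℍ[ℝ]) (B : Matrix (Fin n) (Fin l) ℍ[ℝ]) :
    rk (A * B) ≤ rk A :=
  Submodule.finrank_mono (colSpace_mul_le A B)

lemma rk_eq_of_eq_mul {A : Matrix (Fin m) (Fin n) ℍ[ℝ]} {B : Matrix (Fin m) (Fin l) ℍ[ℝ]}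
    {X : Matrix (Fin l) (Fin n) ℍ[ℝ]} {Y : Matrix (Fin n) (Fin l) ℍ[ℝ]} (hA : A = B * X)
    (hB : B = A * Y) : rk A = rk B :=
  le_antisymm (hA ▸ rk_mul_le B X) (hB ▸ rk_mul_le A Y)

lemma exists_eq_mul_of_rk_eq {A : Matrix (Fin m) (Fin n) ℍ[ℝ]} {B : Matrix (Fin n) (Fin l) ℍ[ℝ]}
    (h : rk (A * B) = rk A) : ∃ Y : Matrix (Fin l) (Fin n) ℍ[ℝ], A = A * B * Y :=
  exists_eq_mul_of_colSpace_le
    (Submodule.eq_of_le_of_finrank_eq (colSpace_mul_le A B) h).ge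

end Rank

section LastMinorSum

variable {ι : Type*} [Fintype ι] [LinearOrder ι]

lemma exists_last_minorSum_ne_zero {R : Type*} [Ring R] [Nontrivial R] (M : Matrix ι ι R) :
    ∃ r ≤ Fintype.card ι, minorSum M r ≠ 0 ∧ ∀ k, r < k → minorSum M k = 0 := by
  classical
  refine ⟨Nat.findGreatest (fun k => minorSum M k ≠ 0) (Fintype.card ι), Nat.findGreatest_le _,
    Nat.findGreatest_spec (P := fun k => minorSum M k ≠ 0) (Nat.zero_le _) ?_, fun k hk => ?_⟩
  · rw [minorSum_zero]
    exact one_ne_zero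
  · obtain h | h := le_or_gt k (Fintype.card ι)
    · exact not_not.1 (Nat.findGreatest_is_greatest hk h)
    · exact minorSum_of_card_lt M h

variable {M : Matrix ι ι ℍ[ℝ]} {r : ℕ}

lemma mul_adjugateSum (hM : M.IsHermitian) (k : ℕ) :
    M * adjugateSum M k = (minorSum M k).re • (1 : Matrix ι ι ℍ[ℝ]) - adjugateSum M (k + 1) :=
  eq_sub_of_add_eq' (adjugateSum_succ_add_mul hM k)

lemma re_trace_mul_adjugateSum (hM : M.IsHermitian) (hr : r ≤ Fintype.card ι) :
    (M * adjugateSum M r).trace.re = r * (minorSum M r).re := by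
  rw [mul_adjugateSum hM, Matrix.trace_sub, trace_adjugateSum_succ, Matrix.trace_smul,
    Matrix.trace_one, Quaternion.re_sub, Quaternion.re_smul, Quaternion.re_natCast,
    ← Nat.cast_smul_eq_nsmul ℝ, Quaternion.re_smul, Nat.cast_sub hr, smul_eq_mul, smul_eq_mul]
  ring

/-- Beyond the last nonzero sum of minors, the adjugate sums satisfy `N_{k+1} = -M * N_k`; since
they vanish eventually, `M` is nilpotent on their columns, hence zero there as it is Hermitian. -/
lemma mul_adjugateSum_succ_eq_zero (hM : M.IsHermitian) (hr : ∀ k, r < k → minorSum M k = 0) :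
    M * adjugateSum M (r + 1) = 0 := by
  have hpow (i : ℕ) : adjugateSum M (r + 1 + i) = (-M) ^ i * adjugateSum M (r + 1) := by
    induction i with
    | zero => rw [add_zero, pow_zero, Matrix.one_mul]
    | succ i ih =>
      rw [← add_assoc, adjugateSum_succ hM, hr _ (by omega), ih, pow_succ', Matrix.mul_assoc,
        Matrix.neg_mul, Quaternion.re_zero, zero_smul, zero_sub]
  have hzero : (-M) ^ (Fintype.card ι + 1) * adjugateSum M (r + 1) = 0 := by
    rw [← hpow, adjugateSum_of_card_lt M (by omega)]
  simpa using mul_eq_zero_of_pow_succ_mul hM.neg hzero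

lemma mul_adjugateSum_mul (hM : M.IsHermitian) (hr : ∀ k, r < k → minorSum M k = 0) :
    M * adjugateSum M r * M = (minorSum M r).re • M := by
  rw [Matrix.mul_assoc, ← (commute_adjugateSum hM r).eq, mul_adjugateSum hM, Matrix.mul_sub,
    mul_adjugateSum_succ_eq_zero hM hr, sub_zero, Matrix.mul_smul, Matrix.mul_one]

end LastMinorSum

section HermitianRank

variable {n : ℕ} {M : Matrix (Fin n) (Fin n) ℍ[ℝ]}

lemma re_minorSum_ne_zero (hM : M.IsHermitian) {k : ℕ} :
    (minorSum M k).re ≠ 0 ↔ minorSum M k ≠ 0 := by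
  conv_rhs => rw [minorSum_eq_coe_re hM, ← Quaternion.coe_zero, Quaternion.coe_injective.ne_iff]

theorem rk_eq_of_last_minorSum (hM : M.IsHermitian) {r : ℕ} (hrn : r ≤ n)
    (h0 : minorSum M r ≠ 0) (hr : ∀ k, r < k → minorSum M k = 0) : rk M = r := by
  have hd : (minorSum M r).re ≠ 0 := (re_minorSum_ne_zero hM).2 h0
  set P := (minorSum M r).re⁻¹ • (M * adjugateSum M r) with hP
  have hPM : P * M = M := by
    rw [hP, Matrix.smul_mul, mul_adjugateSum_mul hM hr, inv_smul_smul₀ hd]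
  have hPP : IsIdempotentElem P := by
    change P * P = P
    rw [hP, Matrix.mul_smul, ← Matrix.mul_assoc, ← hP, hPM]
  have hrk : rk P = rk M :=
    rk_eq_of_eq_mul (X := (minorSum M r).re⁻¹ • adjugateSum M r) (Matrix.mul_smul _ _ _).symm
      hPM.symm
  have htrace : P.trace.re = r := by
    rw [hP, Matrix.trace_smul, Quaternion.re_smul,
      re_trace_mul_adjugateSum hM (by rwa [Fintype.card_fin]), smul_eq_mul, mul_comm,
      mul_inv_cancel_right₀ hd]
  rw [← hrk]
  exact_mod_cast (re_trace_of_isIdempotentElem hPP).symm.trans htrace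

theorem minorSum_rk_ne_zero_and_eq_zero (hM : M.IsHermitian) :
    minorSum M (rk M) ≠ 0 ∧ ∀ k, rk M < k → minorSum M k = 0 := by
  obtain ⟨r, hrn, h0, hr⟩ := exists_last_minorSum_ne_zero M
  rw [rk_eq_of_last_minorSum hM (by rwa [Fintype.card_fin] at hrn) h0 hr]
  exact ⟨h0, hr⟩

lemma minorSum_rk_ne_zero (hM : M.IsHermitian) : minorSum M (rk M) ≠ 0 :=
  (minorSum_rk_ne_zero_and_eq_zero hM).1

lemma re_minorSum_rk_ne_zero (hM : M.IsHermitian) : (minorSum M (rk M)).re ≠ 0 :=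
  (re_minorSum_ne_zero hM).2 (minorSum_rk_ne_zero hM)

/-- The adjugate sum of order `rk M`, divided by the (real) sum of the principal minors of that
order: a Hermitian inner inverse of the Hermitian matrix `M` that commutes with `M`. -/
noncomputable def innerInv (M : Matrix (Fin n) (Fin n) ℍ[ℝ]) : Matrix (Fin n) (Fin n) ℍ[ℝ] :=
  (minorSum M (rk M)).re⁻¹ • adjugateSum M (rk M)

lemma mul_innerInv_mul (hM : M.IsHermitian) : M * innerInv M * M = M := by
  rw [innerInv, Matrix.mul_smul, Matrix.smul_mul,
    mul_adjugateSum_mul hM (minorSum_rk_ne_zero_and_eq_zero hM).2,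
    inv_smul_smul₀ (re_minorSum_rk_ne_zero hM)]

lemma commute_innerInv (hM : M.IsHermitian) : Commute M (innerInv M) :=
  (commute_adjugateSum hM _).smul_right _

lemma isHermitian_innerInv (hM : M.IsHermitian) : (innerInv M).IsHermitian := by
  change _ᴴ = _
  rw [innerInv, conjTranspose_real_smul, (isHermitian_adjugateSum hM _).eq]

theorem of_rowMinorSum_rk_eq_smul {κ : Type*} (hM : M.IsHermitian) (C : Matrix κ (Fin n) ℍ[ℝ]) :
    (Matrix.of fun i j => rowMinorSum M (rk M) j (C.row i)) =
      (minorSum M (rk M)).re • (C * innerInv M) := by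
  rw [innerInv, Matrix.mul_smul, smul_inv_smul₀ (re_minorSum_rk_ne_zero hM)]
  ext1 i j
  exact rowMinorSum_eq_sum M (rk M) j (C.row i)

end HermitianRank

section MoorePenrose

variable {m n : ℕ}

lemma mul_conjTranspose_mul_innerInv_mul (A : Matrix (Fin m) (Fin n) ℍ[ℝ]) :
    A * Aᴴ * innerInv (A * Aᴴ) * A = A := by
  set D := A * Aᴴ * innerInv (A * Aᴴ) * A - A with hD
  have hDA : D * Aᴴ = 0 := by
    rw [hD, Matrix.sub_mul, Matrix.mul_assoc _ A,
      mul_innerInv_mul (Matrix.isHermitian_mul_conjTranspose_self A), sub_self]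
  have hDD : Dᴴᴴ * Dᴴ = 0 := by
    rw [Matrix.conjTranspose_conjTranspose, hD, Matrix.conjTranspose_sub, ← hD, Matrix.mul_sub,
      hDA, Matrix.conjTranspose_mul, ← Matrix.mul_assoc, hDA, Matrix.zero_mul, sub_zero]
  exact sub_eq_zero.1 (Matrix.conjTranspose_eq_zero.1 (eq_zero_of_conjTranspose_mul_self hDD))

lemma isMoorePenrose_innerInv (A : Matrix (Fin m) (Fin n) ℍ[ℝ]) :
    IsMoorePenrose A (Aᴴ * innerInv (A * Aᴴ)) := by
  have hH := Matrix.isHermitian_mul_conjTranspose_self A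
  have hN := isHermitian_innerInv hH
  have hA := mul_conjTranspose_mul_innerInv_mul A
  have hAH : Aᴴ * (innerInv (A * Aᴴ) * (A * Aᴴ)) = Aᴴ := by
    simpa only [Matrix.conjTranspose_mul, hN.eq, hH.eq, Matrix.conjTranspose_conjTranspose]
      using congrArg Matrix.conjTranspose hA
  refine ⟨by rw [← Matrix.mul_assoc, hA], ?_, ?_, ?_⟩
  · calc Aᴴ * innerInv (A * Aᴴ) * A * (Aᴴ * innerInv (A * Aᴴ))
        = Aᴴ * (innerInv (A * Aᴴ) * (A * Aᴴ)) * innerInv (A * Aᴴ) := by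
          simp only [Matrix.mul_assoc]
      _ = Aᴴ * innerInv (A * Aᴴ) := by rw [hAH]
  · rw [← Matrix.mul_assoc, Matrix.conjTranspose_mul, hN.eq, hH.eq, (commute_innerInv hH).eq]
  · rw [Matrix.conjTranspose_mul, Matrix.conjTranspose_mul, hN.eq,
      Matrix.conjTranspose_conjTranspose, Matrix.mul_assoc]

lemma IsMoorePenrose.unique {A : Matrix (Fin m) (Fin n) ℍ[ℝ]} {X Y : Matrix (Fin n) (Fin m) ℍ[ℝ]}
    (hX : IsMoorePenrose A X) (hY : IsMoorePenrose A Y) : X = Y := by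
  obtain ⟨hAXA, hXAX, hAX, hXA⟩ := hX
  obtain ⟨hAYA, hYAY, hAY, hYA⟩ := hY
  have left_eq : A * X = A * Y := by
    calc A * X = A * Y * (A * X) := by rw [← Matrix.mul_assoc, hAYA]
      _ = (A * X * (A * Y))ᴴ := by rw [Matrix.conjTranspose_mul, hAX, hAY]
      _ = A * Y := by rw [← Matrix.mul_assoc, hAXA, hAY]
  have right_eq : X * A = Y * A := by
    calc X * A = X * A * (Y * A) := by rw [Matrix.mul_assoc, ← Matrix.mul_assoc A, hAYA]
      _ = (Y * A * (X * A))ᴴ := by rw [Matrix.conjTranspose_mul, hXA, hYA]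
      _ = Y * A := by rw [Matrix.mul_assoc, ← Matrix.mul_assoc A, hAXA, hYA]
  calc X = X * A * X := hXAX.symm
    _ = Y * A * Y := by rw [right_eq, Matrix.mul_assoc, left_eq, Matrix.mul_assoc]
    _ = Y := hYAY

lemma existsUnique_isMoorePenrose (A : Matrix (Fin m) (Fin n) ℍ[ℝ]) : ∃! Y, IsMoorePenrose A Y :=
  ⟨_, isMoorePenrose_innerInv A, fun _ hY => hY.unique (isMoorePenrose_innerInv A)⟩

lemma isMoorePenrose_moorePenrose (A : Matrix (Fin m) (Fin n) ℍ[ℝ]) :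
    IsMoorePenrose A (moorePenrose A) := by
  rw [moorePenrose, dif_pos (existsUnique_isMoorePenrose A).exists]
  exact Exists.choose_spec _

lemma moorePenrose_eq (A : Matrix (Fin m) (Fin n) ℍ[ℝ]) :
    moorePenrose A = Aᴴ * innerInv (A * Aᴴ) :=
  (isMoorePenrose_moorePenrose A).unique (isMoorePenrose_innerInv A)

lemma rk_mul_conjTranspose (A : Matrix (Fin m) (Fin n) ℍ[ℝ]) : rk (A * Aᴴ) = rk A :=
  rk_eq_of_eq_mul (X := Aᴴ) (Y := innerInv (A * Aᴴ) * A) rfl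
    (by rw [← Matrix.mul_assoc, mul_conjTranspose_mul_innerInv_mul])

lemma rk_conjTranspose (A : Matrix (Fin m) (Fin n) ℍ[ℝ]) : rk Aᴴ = rk A := by
  obtain ⟨hAXA, hXAX, -, hXA⟩ := isMoorePenrose_moorePenrose A
  set X := moorePenrose A
  have hrk : rk (A * X) = rk A := rk_eq_of_eq_mul (Y := A) rfl hAXA.symm
  have hrkH : rk (X * A) = rk Aᴴ := by
    refine rk_eq_of_eq_mul (X := Xᴴ) (Y := Aᴴ) ?_ ?_
    · rw [← Matrix.conjTranspose_mul, hXA]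
    · rw [← hXA, ← Matrix.conjTranspose_mul, ← Matrix.mul_assoc, hAXA]
  have idem_left : IsIdempotentElem (A * X) := by
    change A * X * (A * X) = A * X
    rw [← Matrix.mul_assoc, hAXA]
  have idem_right : IsIdempotentElem (X * A) := by
    change X * A * (X * A) = X * A
    rw [← Matrix.mul_assoc, hXAX]
  have htrace : (rk (X * A) : ℝ) = rk (A * X) :=
    (re_trace_of_isIdempotentElem idem_right).symm.trans
      ((re_trace_mul_comm X A).trans (re_trace_of_isIdempotentElem idem_left))
  rw [← hrk, ← hrkH]
  exact_mod_cast htrace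

lemma minorSum_mul_conjTranspose_ne_zero (A : Matrix (Fin m) (Fin n) ℍ[ℝ]) :
    minorSum (A * Aᴴ) (rk A) ≠ 0 := by
  rw [← rk_mul_conjTranspose]
  exact minorSum_rk_ne_zero (Matrix.isHermitian_mul_conjTranspose_self A)

/-- Cramer's rule for the Moore-Penrose inverse. -/
theorem of_rowMinorSum_mul_conjTranspose {κ : Type*} (A : Matrix (Fin m) (Fin n) ℍ[ℝ])
    (C : Matrix κ (Fin n) ℍ[ℝ]) :
    (Matrix.of fun i j => rowMinorSum (A * Aᴴ) (rk A) j ((C * Aᴴ).row i)) =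
      (minorSum (A * Aᴴ) (rk A)).re • (C * moorePenrose A) := by
  rw [← rk_mul_conjTranspose,
    of_rowMinorSum_rk_eq_smul (Matrix.isHermitian_mul_conjTranspose_self A) (C * Aᴴ),
    moorePenrose_eq, Matrix.mul_assoc]

end MoorePenrose

section Drazin

variable {S : Type*} [Monoid S] {T Y Z : S} {p : ℕ}

lemma pow_add_mul_pow_of_pow_succ_mul (h : T ^ (p + 1) * Y = T ^ p) (i : ℕ) :
    T ^ (p + i) * Y ^ i = T ^ p := by
  induction i with
  | zero => rw [add_zero, pow_zero, mul_one]
  | succ i ih =>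
    calc T ^ (p + (i + 1)) * Y ^ (i + 1) = T ^ i * (T ^ (p + 1) * Y) * Y ^ i := by
          rw [show p + (i + 1) = i + (p + 1) by omega, pow_add, pow_succ' Y]
          simp only [mul_assoc]
      _ = T ^ p := by rw [h, ← pow_add, add_comm i, ih]

lemma pow_mul_pow_add_of_mul_pow_succ (h : Z * T ^ (p + 1) = T ^ p) (i : ℕ) :
    Z ^ i * T ^ (p + i) = T ^ p := by
  induction i with
  | zero => rw [add_zero, pow_zero, one_mul]
  | succ i ih =>
    calc Z ^ (i + 1) * T ^ (p + (i + 1)) = Z ^ i * (Z * T ^ (p + 1)) * T ^ i := by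
          rw [show p + (i + 1) = p + 1 + i by omega, pow_add T, pow_succ Z]
          simp only [mul_assoc]
      _ = T ^ p := by rw [h, mul_assoc, ← pow_add, ih]

/-- `E` is a Drazin inverse of `T` of exponent at most `p`. -/
structure IsDrazin {S : Type*} [Monoid S] (T E : S) (p : ℕ) : Prop where
  commute : Commute T E
  outer : E * T * E = E
  pow_succ_mul : T ^ (p + 1) * E = T ^ p

namespace IsDrazin

variable {E F : S} {q : ℕ}

lemma outer_left (h : IsDrazin T E p) : T * E * E = E := by
  rw [h.commute.eq, h.outer]

lemma outer_right (h : IsDrazin T E p) : E * E * T = E := by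
  rw [mul_assoc, ← h.commute.eq, ← mul_assoc, h.outer]

lemma mono (h : IsDrazin T E p) (hpq : p ≤ q) : IsDrazin T E q := by
  refine ⟨h.commute, h.outer, ?_⟩
  obtain ⟨j, rfl⟩ := Nat.exists_eq_add_of_le' hpq
  rw [add_assoc, pow_add, mul_assoc, h.pow_succ_mul, pow_add]

lemma pow_add_mul_pow (h : IsDrazin T E p) (i : ℕ) : T ^ (p + i) * E ^ i = T ^ p :=
  pow_add_mul_pow_of_pow_succ_mul h.pow_succ_mul i

lemma pow_mul_pow_add (h : IsDrazin T E p) (i : ℕ) : E ^ i * T ^ (p + i) = T ^ p := by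
  rw [← (h.commute.pow_pow _ _).eq, h.pow_add_mul_pow]

lemma pow_succ_mul_pow (h : IsDrazin T E p) (i : ℕ) : E ^ (i + 1) * T ^ i = E := by
  induction i with
  | zero => simp
  | succ i ih =>
    calc E ^ (i + 1 + 1) * T ^ (i + 1) = E * (E ^ (i + 1) * T ^ i) * T := by
          rw [pow_succ' E, pow_succ T]
          simp only [mul_assoc]
      _ = E := by rw [ih, h.outer_right]

theorem unique (hE : IsDrazin T E p) (hF : IsDrazin T F q) : E = F := by
  wlog hpq : p ≤ q generalizing E F p q
  · exact (this hF hE (le_of_not_ge hpq)).symm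
  replace hE := hE.mono hpq
  calc E = E ^ (q + 1) * T ^ q := (hE.pow_succ_mul_pow q).symm
    _ = E ^ (q + 1) * (T ^ (q + (q + 1)) * F ^ (q + 1)) := by rw [hF.pow_add_mul_pow]
    _ = T ^ q * F ^ (q + 1) := by rw [← mul_assoc, hE.pow_mul_pow_add]
    _ = F := by rw [(hF.commute.pow_pow _ _).eq, hF.pow_succ_mul_pow]

theorem pow_mul_mul_pow (h : IsDrazin T E p) {G : S} {a b l : ℕ} (ha : p ≤ a) (hb : p ≤ b)
    (hG : T ^ l * G * T ^ l = T ^ l) : T ^ a * G * T ^ b = E ^ l * T ^ (a + b) := by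
  calc T ^ a * G * T ^ b = E ^ l * T ^ (a + l) * G * (T ^ (b + l) * E ^ l) := by
        rw [(h.mono ha).pow_mul_pow_add, (h.mono hb).pow_add_mul_pow]
    _ = E ^ l * T ^ a * (T ^ l * G * T ^ l) * (T ^ b * E ^ l) := by
        rw [pow_add, add_comm b, pow_add]
        simp only [mul_assoc]
    _ = E ^ l * T ^ a * (T ^ (b + l) * E ^ l) := by
        rw [hG, add_comm b, pow_add]
        simp only [mul_assoc]
    _ = E ^ l * T ^ (a + b) := by rw [(h.mono hb).pow_add_mul_pow, mul_assoc, ← pow_add]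

end IsDrazin

theorem exists_isDrazin_of_pow_eq (hY : T ^ (p + 1) * Y = T ^ p) (hZ : Z * T ^ (p + 1) = T ^ p) :
    ∃ E, IsDrazin T E p := by
  have hY' := pow_add_mul_pow_of_pow_succ_mul hY (p + 1)
  have hZ' := pow_mul_pow_add_of_mul_pow_succ hZ (p + 1)
  have hE : T ^ p * Y ^ (p + 1) = Z ^ (p + 1) * T ^ p := by
    conv_lhs => rw [← hZ', mul_assoc, hY']
  have comm : T * (T ^ p * Y ^ (p + 1)) = T ^ p * Y ^ (p + 1) * T := by
    calc T * (T ^ p * Y ^ (p + 1))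
        = Z ^ (p + 1) * T ^ (p + (p + 1)) * T * Y ^ (p + 1) := by
          rw [hZ', pow_mul_comm', mul_assoc]
      _ = Z ^ (p + 1) * T * (T ^ (p + (p + 1)) * Y ^ (p + 1)) := by
          rw [mul_assoc (Z ^ (p + 1)), pow_mul_comm']
          simp only [mul_assoc]
      _ = T ^ p * Y ^ (p + 1) * T := by rw [hY', hE, mul_assoc, mul_assoc, pow_mul_comm']
  refine ⟨T ^ p * Y ^ (p + 1), comm, ?_, ?_⟩
  · calc T ^ p * Y ^ (p + 1) * T * (T ^ p * Y ^ (p + 1))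
        = Z ^ (p + 1) * T ^ p * T * (T ^ p * Y ^ (p + 1)) := congrArg (· * T * _) hE
      _ = Z ^ (p + 1) * (T ^ (p + (p + 1)) * Y ^ (p + 1)) := by
          rw [pow_add T p, pow_succ' T p]
          simp only [mul_assoc]
      _ = T ^ p * Y ^ (p + 1) := by rw [hY', hE]
  · rw [← mul_assoc, ← pow_add, add_comm (p + 1), hY']

end Drazin

section Index

variable {n : ℕ}

lemma ind_spec (T : Matrix (Fin n) (Fin n) ℍ[ℝ]) : rk (T ^ (ind T + 1)) = rk (T ^ ind T) := by
  have antitone_rk : Antitone fun k => rk (T ^ k) :=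
    antitone_nat_of_succ_le fun k => by
      rw [pow_succ]
      exact rk_mul_le _ _
  obtain ⟨N, hN⟩ := WellFoundedLT.antitone_chain_condition antitone_rk
  have hne : {k : ℕ | 0 < k ∧ rk (T ^ (k + 1)) = rk (T ^ k)}.Nonempty :=
    ⟨N + 1, N.succ_pos, (hN _ (by omega)).symm.trans (hN _ N.le_succ)⟩
  exact (Nat.sInf_mem hne).2

lemma exists_pow_succ_mul_eq_pow {T : Matrix (Fin n) (Fin n) ℍ[ℝ]} {p : ℕ}
    (hp : rk (T ^ (p + 1)) = rk (T ^ p)) :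
    ∃ Y : Matrix (Fin n) (Fin n) ℍ[ℝ], T ^ (p + 1) * Y = T ^ p := by
  rw [pow_succ] at hp ⊢
  exact (exists_eq_mul_of_rk_eq hp).imp fun _ => Eq.symm

lemma exists_mul_pow_succ_eq_pow {T : Matrix (Fin n) (Fin n) ℍ[ℝ]} {p : ℕ}
    (hp : rk (T ^ (p + 1)) = rk (T ^ p)) :
    ∃ Z : Matrix (Fin n) (Fin n) ℍ[ℝ], Z * T ^ (p + 1) = T ^ p := by
  obtain ⟨Y, hY⟩ := exists_pow_succ_mul_eq_pow (T := Tᴴ) (p := p) (by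
    rw [← Matrix.conjTranspose_pow, ← Matrix.conjTranspose_pow, rk_conjTranspose, rk_conjTranspose,
      hp])
  refine ⟨Yᴴ, ?_⟩
  simpa only [Matrix.conjTranspose_mul, Matrix.conjTranspose_pow,
    Matrix.conjTranspose_conjTranspose] using congrArg Matrix.conjTranspose hY

theorem exists_isDrazin {T : Matrix (Fin n) (Fin n) ℍ[ℝ]} {k : ℕ} (hk : ind T ≤ k) :
    ∃ E : Matrix (Fin n) (Fin n) ℍ[ℝ], IsDrazin T E k := by
  obtain ⟨Y, hY⟩ := exists_pow_succ_mul_eq_pow (ind_spec T)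
  obtain ⟨Z, hZ⟩ := exists_mul_pow_succ_eq_pow (ind_spec T)
  exact (exists_isDrazin_of_pow_eq hY hZ).imp fun _ hE => hE.mono hk

lemma IsDrazin.rk_pow_add {T E : Matrix (Fin n) (Fin n) ℍ[ℝ]} {k : ℕ} (h : IsDrazin T E k)
    (i : ℕ) : rk (T ^ (k + i)) = rk (T ^ k) :=
  rk_eq_of_eq_mul (pow_add T k i) (h.pow_add_mul_pow i).symm

lemma IsDrazin.one_of_isHermitian {T E : Matrix (Fin n) (Fin n) ℍ[ℝ]} {k : ℕ}
    (h : IsDrazin T E k) (hT : T.IsHermitian) : IsDrazin T E 1 := by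
  have hzero : T ^ (k + 1) * (T * E - 1) = 0 := by
    rw [mul_sub, ← mul_assoc, ← pow_succ, (h.mono k.le_succ).pow_succ_mul, mul_one, sub_self]
  have hT' := mul_eq_zero_of_pow_succ_mul hT hzero
  rw [mul_sub, mul_one, sub_eq_zero, ← mul_assoc] at hT'
  exact ⟨h.commute, h.outer, by rwa [pow_one, one_add_one_eq_two, sq]⟩

end Index

section WeightedDrazin

variable {m n : ℕ} {A : Matrix (Fin m) (Fin n) ℍ[ℝ]} {W : Matrix (Fin n) (Fin m) ℍ[ℝ]}

lemma isWeightedDrazin_iff {E : Matrix (Fin m) (Fin m) ℍ[ℝ]} {X : Matrix (Fin m) (Fin n) ℍ[ℝ]}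
    (hE : IsDrazin (A * W) E (ind (A * W))) : IsWeightedDrazin A W X ↔ X = E * E * A := by
  constructor
  · rintro ⟨hpow, houter, hcomm⟩
    have hXW : IsDrazin (A * W) (X * W) (ind (A * W)) := by
      refine ⟨?_, ?_, ?_⟩
      · change A * W * (X * W) = X * W * (A * W)
        rw [← Matrix.mul_assoc, hcomm, Matrix.mul_assoc]
      · rw [← Matrix.mul_assoc, ← Matrix.mul_assoc, houter]
      · rw [← Matrix.mul_assoc, hpow]
    calc X = X * W * (A * W * X) := by rw [← Matrix.mul_assoc, ← Matrix.mul_assoc, houter]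
      _ = X * W * (X * W) * A := by rw [hcomm, ← Matrix.mul_assoc]
      _ = E * E * A := by rw [hXW.unique hE]
  · rintro rfl
    refine ⟨?_, ?_, ?_⟩
    · calc (A * W) ^ (ind (A * W) + 1) * (E * E * A) * W
          = (A * W) ^ (ind (A * W) + 1) * (E * E * (A * W)) := by simp only [Matrix.mul_assoc]
        _ = (A * W) ^ ind (A * W) := by rw [hE.outer_right, hE.pow_succ_mul]
    · calc E * E * A * W * A * W * (E * E * A)
          = E * E * (A * W) * (A * W * E * E) * A := by simp only [Matrix.mul_assoc]
        _ = E * E * A := by rw [hE.outer_right, hE.outer_left]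
    · calc A * W * (E * E * A) = A * W * E * E * A := by simp only [Matrix.mul_assoc]
        _ = E * E * (A * W) * A := by rw [hE.outer_left, hE.outer_right]
        _ = E * E * A * W * A := by simp only [Matrix.mul_assoc]

lemma existsUnique_isWeightedDrazin (A : Matrix (Fin m) (Fin n) ℍ[ℝ])
    (W : Matrix (Fin n) (Fin m) ℍ[ℝ]) : ∃! X, IsWeightedDrazin A W X := by
  obtain ⟨E, hE⟩ := exists_isDrazin (le_refl (ind (A * W)))
  exact ⟨E * E * A, (isWeightedDrazin_iff hE).2 rfl, fun X => (isWeightedDrazin_iff hE).1⟩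

lemma isWeightedDrazin_weightedDrazin (A : Matrix (Fin m) (Fin n) ℍ[ℝ])
    (W : Matrix (Fin n) (Fin m) ℍ[ℝ]) : IsWeightedDrazin A W (weightedDrazin A W) := by
  rw [weightedDrazin, dif_pos (existsUnique_isWeightedDrazin A W).exists]
  exact Exists.choose_spec _

lemma mul_pow_mul {R : Type*} [Semiring R] (A : Matrix (Fin m) (Fin n) R)
    (W : Matrix (Fin n) (Fin m) R) (p : ℕ) : W * (A * W) ^ p * A = (W * A) ^ (p + 1) := by
  induction p with
  | zero => simp
  | succ p ih =>
    rw [pow_succ (W * A), ← ih, pow_succ]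
    simp only [Matrix.mul_assoc]

/-- Cline's formula. -/
lemma IsDrazin.cline {R : Type*} [Semiring R] {A : Matrix (Fin m) (Fin n) R}
    {W : Matrix (Fin n) (Fin m) R} {E : Matrix (Fin m) (Fin m) R} {p : ℕ}
    (hE : IsDrazin (A * W) E p) : IsDrazin (W * A) (W * (E * E * A)) (p + 1) := by
  have hleft : W * A * (W * (E * E * A)) = W * E * A := by
    calc W * A * (W * (E * E * A)) = W * (A * W * E * E) * A := by simp only [Matrix.mul_assoc]
      _ = W * E * A := by rw [hE.outer_left]
  have hright : W * (E * E * A) * (W * A) = W * E * A := by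
    calc W * (E * E * A) * (W * A) = W * (E * E * (A * W)) * A := by simp only [Matrix.mul_assoc]
      _ = W * E * A := by rw [hE.outer_right]
  refine ⟨hleft.trans hright.symm, ?_, ?_⟩
  · calc W * (E * E * A) * (W * A) * (W * (E * E * A)) = W * (E * (A * W) * E) * E * A := by
          rw [hright]
          simp only [Matrix.mul_assoc]
      _ = W * (E * E * A) := by
          rw [hE.outer]
          simp only [Matrix.mul_assoc]
  · calc (W * A) ^ (p + 1 + 1) * (W * (E * E * A)) = W * (A * W) ^ p * A * (W * E * A) := by
          rw [pow_succ, Matrix.mul_assoc, hleft, mul_pow_mul]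
      _ = W * ((A * W) ^ (p + 1) * E) * A := by
          rw [pow_succ]
          simp only [Matrix.mul_assoc]
      _ = (W * A) ^ (p + 1) := by rw [hE.pow_succ_mul, mul_pow_mul]

theorem IsDrazin.wdmp_eq {E : Matrix (Fin n) (Fin n) ℍ[ℝ]} {p : ℕ} (hE : IsDrazin (W * A) E p) :
    wdmp A W = E * (W * A) * moorePenrose A := by
  obtain ⟨F, hF⟩ := exists_isDrazin (le_refl (ind (A * W)))
  rw [wdmp, (isWeightedDrazin_iff hF).1 (isWeightedDrazin_weightedDrazin A W),
    hF.cline.unique hE, Matrix.mul_assoc E]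

end WeightedDrazin

section Representation

variable {m n k : ℕ} {A : Matrix (Fin m) (Fin n) ℍ[ℝ]} {W : Matrix (Fin n) (Fin m) ℍ[ℝ]}
  {U E : Matrix (Fin n) (Fin n) ℍ[ℝ]}

theorem IsDrazin.wdmp_apply {p : ℕ} (hE : IsDrazin (W * A) E p) {Ω : Matrix (Fin n) (Fin n) ℍ[ℝ]}
    {c : ℝ} (hc : c ≠ 0) (hΩ : Ω = c • (E * (W * A))) (i : Fin n) (j : Fin m) :
    wdmp A W i j = rowMinorSum (A * Aᴴ) (rk A) j ((Ω * Aᴴ).row i) /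
      (minorSum (A * Aᴴ) (rk A) * (c : ℍ[ℝ])) := by
  have hA := Matrix.isHermitian_mul_conjTranspose_self A
  have hd : (minorSum (A * Aᴴ) (rk A)).re * c ≠ 0 :=
    mul_ne_zero ((re_minorSum_ne_zero hA).2 (minorSum_mul_conjTranspose_ne_zero A)) hc
  have cramer : rowMinorSum (A * Aᴴ) (rk A) j ((Ω * Aᴴ).row i) =
      ((minorSum (A * Aᴴ) (rk A)).re * c) • wdmp A W i j := by
    rw [hE.wdmp_eq, mul_smul, ← Matrix.smul_apply c, ← Matrix.smul_mul, ← hΩ,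
      ← Matrix.smul_apply, ← of_rowMinorSum_mul_conjTranspose, Matrix.of_apply]
  rw [cramer, minorSum_eq_coe_re hA, Quaternion.re_coe, ← Quaternion.coe_mul,
    ← Quaternion.coe_mul_eq_smul, Quaternion.coe_commutes,
    mul_div_cancel_right₀ _ (Quaternion.coe_injective.ne_iff' Quaternion.coe_zero |>.2 hd)]

lemma IsDrazin.pow_mul_moorePenrose_mul_pow (hE : IsDrazin U E k) :
    U ^ k * moorePenrose (U ^ (2 * k + 1)) * U ^ k = E := by
  rw [hE.pow_mul_mul_pow le_rfl le_rfl (isMoorePenrose_moorePenrose (U ^ (2 * k + 1))).1,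
    ← two_mul, hE.pow_succ_mul_pow]

lemma IsDrazin.pow_succ_mul_innerInv_mul (hE : IsDrazin U E k) (hU : U.IsHermitian) :
    U ^ (k + 1) * innerInv (U ^ (k + 2)) * U = E * U := by
  have h := (hE.one_of_isHermitian hU).pow_mul_mul_pow (Nat.le_add_left 1 k) le_rfl
    (mul_innerInv_mul (hU.pow (k + 2)))
  rw [pow_one] at h
  rw [h, pow_succ U, ← mul_assoc, hE.pow_succ_mul_pow]

lemma IsDrazin.rk_pow_two_mul_add_one (hE : IsDrazin U E k) :
    rk (U ^ (2 * k + 1)) = rk (U ^ k) := by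
  rw [two_mul, add_assoc, hE.rk_pow_add]

lemma IsDrazin.minorSum_pow_mul_conjTranspose_ne_zero (hE : IsDrazin U E k) :
    minorSum (U ^ (2 * k + 1) * (U ^ (2 * k + 1))ᴴ) (rk (U ^ k)) ≠ 0 := by
  rw [← hE.rk_pow_two_mul_add_one]
  exact minorSum_mul_conjTranspose_ne_zero _

lemma IsDrazin.minorSum_pow_ne_zero (hE : IsDrazin U E k) (hU : U.IsHermitian) :
    minorSum (U ^ (k + 2)) (rk (U ^ k)) ≠ 0 := by
  rw [← hE.rk_pow_add 2]
  exact minorSum_rk_ne_zero (hU.pow _)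

theorem IsDrazin.cramer_mul_pow (hE : IsDrazin U E k)
    {Φ Ω : Matrix (Fin n) (Fin n) ℍ[ℝ]}
    (hΦ : ∀ l q, Φ l q = rowMinorSum (U ^ (2 * k + 1) * (U ^ (2 * k + 1))ᴴ) (rk (U ^ k)) q
      ((U ^ k * (U ^ (2 * k + 1))ᴴ).row l))
    (hΩ : ∀ i s, Ω i s = rowMinorSum (U ^ (2 * k + 1) * (U ^ (2 * k + 1))ᴴ) (rk (U ^ k)) s
      ((U * Φ * U ^ (2 * k) * (U ^ (2 * k + 1))ᴴ).row i)) :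
    Ω * U ^ (k + 1) =
      ((minorSum (U ^ (2 * k + 1) * (U ^ (2 * k + 1))ᴴ) (rk (U ^ k))).re ^ 2) • (E * U) := by
  rw [← hE.rk_pow_two_mul_add_one] at hΦ hΩ ⊢
  have hG := hE.pow_mul_moorePenrose_mul_pow
  replace hΦ := (Matrix.ext hΦ).trans (of_rowMinorSum_mul_conjTranspose (U ^ (2 * k + 1)) (U ^ k))
  replace hΩ := (Matrix.ext hΩ).trans
    (of_rowMinorSum_mul_conjTranspose (U ^ (2 * k + 1)) (U * Φ * U ^ (2 * k)))
  set G := moorePenrose (U ^ (2 * k + 1))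
  set d := (minorSum (U ^ (2 * k + 1) * (U ^ (2 * k + 1))ᴴ) (rk (U ^ (2 * k + 1)))).re
  calc Ω * U ^ (k + 1) = d ^ 2 • (U * (U ^ k * G * U ^ k) * (U ^ k * G * U ^ k) * U) := by
        rw [hΩ, hΦ, two_mul, pow_add U k k, pow_succ U k]
        simp only [Matrix.mul_smul, Matrix.smul_mul, smul_smul, Matrix.mul_assoc, sq]
    _ = d ^ 2 • (E * U) := by rw [hG, hE.outer_left]

theorem IsDrazin.cramer_mul_of_isHermitian (hE : IsDrazin U E k) (hU : U.IsHermitian)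
    {Ω : Matrix (Fin n) (Fin n) ℍ[ℝ]}
    (hΩ : ∀ i s, Ω i s = rowMinorSum (U ^ (k + 2)) (rk (U ^ k)) s ((U ^ (k + 1)).row i)) :
    Ω * U = (minorSum (U ^ (k + 2)) (rk (U ^ k))).re • (E * U) := by
  rw [← hE.rk_pow_add 2] at hΩ ⊢
  rw [(Matrix.ext hΩ).trans (of_rowMinorSum_rk_eq_smul (hU.pow (k + 2)) (U ^ (k + 1))),
    Matrix.smul_mul, hE.pow_succ_mul_innerInv_mul hU]

end Representation

end QMat

theorem theorem4p5_general (m n r r₁ k : ℕ)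
    (A : Matrix (Fin m) (Fin n) ℍ[ℝ]) (W : Matrix (Fin n) (Fin m) ℍ[ℝ])
    (U : Matrix (Fin n) (Fin n) ℍ[ℝ])
    (hr : QMat.rk A = r) (hU : U = W * A) (hk : QMat.ind (W * A) ≤ k)
    (hr₁ : QMat.rk (U ^ k) = r₁) :
    (∃! X, QMat.IsWeightedDrazin A W X) ∧ (∃! Y, QMat.IsMoorePenrose A Y) ∧
    QMat.minorSum (A * Aᴴ) r ≠ 0 ∧
    QMat.minorSum (U ^ (2 * k + 1) * (U ^ (2 * k + 1))ᴴ) r₁ ≠ 0 ∧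
    ((W * A).IsHermitian → QMat.minorSum ((W * A) ^ (k + 2)) r₁ ≠ 0) ∧
    (∀ Ucheck Φ Φhat Ω : Matrix (Fin n) (Fin n) ℍ[ℝ], ∀ Ωtilde : Matrix (Fin n) (Fin m) ℍ[ℝ],
      Ucheck = U ^ k * (U ^ (2 * k + 1))ᴴ →
      (∀ l q, Φ l q =
        QMat.rowMinorSum (U ^ (2 * k + 1) * (U ^ (2 * k + 1))ᴴ) r₁ q (Ucheck.row l)) →
      Φhat = W * A * Φ * U ^ (2 * k) * (U ^ (2 * k + 1))ᴴ →
      (∀ i s, Ω i s =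
        QMat.rowMinorSum (U ^ (2 * k + 1) * (U ^ (2 * k + 1))ᴴ) r₁ s (Φhat.row i)) →
      Ωtilde = Ω * (W * A) ^ (k + 1) * Aᴴ →
      ∀ (i : Fin n) (j : Fin m), QMat.wdmp A W i j =
        QMat.rowMinorSum (A * Aᴴ) r j (Ωtilde.row i) /
          (QMat.minorSum (A * Aᴴ) r *
            QMat.minorSum (U ^ (2 * k + 1) * (U ^ (2 * k + 1))ᴴ) r₁ ^ 2)) ∧
    ((W * A).IsHermitian →
      ∀ Uhat Ω : Matrix (Fin n) (Fin n) ℍ[ℝ], ∀ Ωtilde : Matrix (Fin n) (Fin m) ℍ[ℝ],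
      Uhat = (W * A) ^ (k + 1) →
      (∀ i s, Ω i s = QMat.rowMinorSum ((W * A) ^ (k + 2)) r₁ s (Uhat.row i)) →
      Ωtilde = Ω * W * A * Aᴴ →
      ∀ (i : Fin n) (j : Fin m), QMat.wdmp A W i j =
        QMat.rowMinorSum (A * Aᴴ) r j (Ωtilde.row i) /
          (QMat.minorSum (A * Aᴴ) r * QMat.minorSum ((W * A) ^ (k + 2)) r₁)) := by
  subst hr hU hr₁
  obtain ⟨E, hE⟩ := QMat.exists_isDrazin hk
  refine ⟨QMat.existsUnique_isWeightedDrazin A W, QMat.existsUnique_isMoorePenrose A,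
    QMat.minorSum_mul_conjTranspose_ne_zero A, hE.minorSum_pow_mul_conjTranspose_ne_zero,
    hE.minorSum_pow_ne_zero, ?_, fun hWA => ?_⟩
  · rintro _ Φ _ Ω _ rfl hΦ rfl hΩ rfl i j
    have hB := Matrix.isHermitian_mul_conjTranspose_self ((W * A) ^ (2 * k + 1))
    have hd := (QMat.re_minorSum_ne_zero hB).2 hE.minorSum_pow_mul_conjTranspose_ne_zero
    rw [QMat.minorSum_eq_coe_re hB, ← Quaternion.coe_pow]
    exact hE.wdmp_apply (pow_ne_zero 2 hd) (hE.cramer_mul_pow hΦ hΩ) i j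
  · rintro _ Ω _ rfl hΩ rfl i j
    have hd := (QMat.re_minorSum_ne_zero (hWA.pow (k + 2))).2 (hE.minorSum_pow_ne_zero hWA)
    rw [QMat.minorSum_eq_coe_re (hWA.pow (k + 2)), Matrix.mul_assoc Ω]
    exact hE.wdmp_apply hd (hE.cramer_mul_of_isHermitian hWA hΩ) i j

theorem theorem4p5 (m n r r₁ k : ℕ)
    (A : Matrix (Fin m) (Fin n) ℍ[ℝ]) (W : Matrix (Fin n) (Fin m) ℍ[ℝ])
    (U : Matrix (Fin n) (Fin n) ℍ[ℝ])
    (hr : QMat.rk A = r) (hW : W ≠ 0) (hU : U = W * A)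
    (hk : k = max (QMat.ind (W * A)) (QMat.ind (A * W)))
    (hr₁ : QMat.rk (U ^ k) = r₁) :
    -- the generalized inverses that enter the weighted DMP inverse exist and are unique
    (∃! X, QMat.IsWeightedDrazin A W X) ∧ (∃! Y, QMat.IsMoorePenrose A Y) ∧
    -- the denominators do not vanish
    QMat.minorSum (A * Aᴴ) r ≠ 0 ∧
    QMat.minorSum (U ^ (2 * k + 1) * (U ^ (2 * k + 1))ᴴ) r₁ ≠ 0 ∧
    ((W * A).IsHermitian → QMat.minorSum ((W * A) ^ (k + 2)) r₁ ≠ 0) ∧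
    -- (i) arbitrary `W * A`
    (∀ Ucheck Φ Φhat Ω : Matrix (Fin n) (Fin n) ℍ[ℝ], ∀ Ωtilde : Matrix (Fin n) (Fin m) ℍ[ℝ],
      Ucheck = U ^ k * (U ^ (2 * k + 1))ᴴ →
      (∀ l q, Φ l q =
        QMat.rowMinorSum (U ^ (2 * k + 1) * (U ^ (2 * k + 1))ᴴ) r₁ q (Ucheck.row l)) →
      Φhat = W * A * Φ * U ^ (2 * k) * (U ^ (2 * k + 1))ᴴ →
      (∀ i s, Ω i s =
        QMat.rowMinorSum (U ^ (2 * k + 1) * (U ^ (2 * k + 1))ᴴ) r₁ s (Φhat.row i)) →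
      Ωtilde = Ω * (W * A) ^ (k + 1) * Aᴴ →
      ∀ (i : Fin n) (j : Fin m), QMat.wdmp A W i j =
        QMat.rowMinorSum (A * Aᴴ) r j (Ωtilde.row i) /
          (QMat.minorSum (A * Aᴴ) r *
            QMat.minorSum (U ^ (2 * k + 1) * (U ^ (2 * k + 1))ᴴ) r₁ ^ 2)) ∧
    -- (ii) Hermitian `W * A`
    ((W * A).IsHermitian →
      ∀ Uhat Ω : Matrix (Fin n) (Fin n) ℍ[ℝ], ∀ Ωtilde : Matrix (Fin n) (Fin m) ℍ[ℝ],
      Uhat = (W * A) ^ (k + 1) →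
      (∀ i s, Ω i s = QMat.rowMinorSum ((W * A) ^ (k + 2)) r₁ s (Uhat.row i)) →
      Ωtilde = Ω * W * A * Aᴴ →
      ∀ (i : Fin n) (j : Fin m), QMat.wdmp A W i j =
        QMat.rowMinorSum (A * Aᴴ) r j (Ωtilde.row i) /
          (QMat.minorSum (A * Aᴴ) r * QMat.minorSum ((W * A) ^ (k + 2)) r₁)) :=
  theorem4p5_general m n r r₁ k A W U hr hU (hk ▸ le_max_left _ _) hr₁
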